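/- **Setting.** Let $(\Omega,\mathcal A,\mathbb P)$ be a complete probability space with expectation $\mathbb E$, $(E,\|\cdot\|_E)$ a real Banach space with dual $E'$, closed dual unit ball $B_{E'}$, and $\mathbb N=\{1,2,\dots\}$. For $r\in[1,\infty)$ and a Banach space $F$, $L_r(\Omega;F)$ is the Bochner space with norm $\|\eta\|_{L_r(\Omega;F)}=(\mathbb E\|\eta\|_F^r)^{1/r}$. *Tensor products.* For $k\in\mathbb N$, the (full) injective tensor product $\otimes^k_\varepsilon E$ is the completion of the algebraic tensor product $\otimes^kE$ with respect to $$\|U\|_\varepsilon=\sup\{|(f_1\otimes\cdots\otimes f_k)(U)| : f_1,\dots,f_k\in B_{E'}\}.$$ The symmetric algebraic tensor product $\otimes^{k,s}E$ is the linear span in $\otimes^k E$ of all symmetrizations $s(x_1\otimes\cdots\otimes x_k)=\frac1{k!}\sum_{\sigma\in S_k}x_{\sigma(1)}\otimes\cdots\otimes x_{\sigma(k)}$, and the symmetric injective tensor product $\otimes^{k,s}_{\varepsilon_s}E$ is its completion with respect to $\|U\|_{\varepsilon_s}=\sup_{f\in B_{E'}}|(f\otimes\cdots\otimes f)(U)|$.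 Write $\otimes^kx=x\otimes\cdots\otimes x$. For $\xi\in L_k(\Omega;E)$ the injective $k$th moment is the Bochner integral $\mathbb M^k_\varepsilon[\xi]=\mathbb E[\otimes^k\xi]$ in $\otimes^k_\varepsilon E$; it exists, and it is regarded as an element of $\otimes^{k,s}_{\varepsilon_s}E$ through the continuous extension $\otimes^k_\varepsilon E\to\otimes^{k,s}_{\varepsilon_s}E$ of the symmetrization, which leaves it unchanged. *Constants.* A Rademacher family is a sequence $(r_j)_{j\in\mathbb N}$ of independent random variables on a complete probability space $(\widetilde\Omega,\widetilde{\mathcal A},\widetilde{\mathbb P})$ with $\widetilde{\mathbb P}(r_j=1)=\widetilde{\mathbb P}(r_j=-1)=\frac12$. A Banach space $F$ has Rademacher type $p\in[1,2]$ if there is $\tau\in(0,\infty)$ such that $\|\sum_{j=1}^nr_jx_j\|_{L_p(\widetilde\Omega;F)}\le\tau(\sum_{j=1}^n\|x_j\|_F^p)^{1/p}$ for all Rademacher families, all $n$ and all $x_1,\dots,x_n\in F$; $\tau_p(F)$ is the infimum of such $\tau$. For $p,q\in[1,\infty)$, $K_{q,p}$ is the smallest $K\in(0,\infty)$ such that $\|\sum_{j=1}^nr_jx_j\|_{L_q(\widetilde\Omega;F)}\le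 K\|\sum_{j=1}^nr_jx_j\|_{L_p(\widetilde\Omega;F)}$ for all Rademacher families, all real Banach spaces $F$, all $n$ and all $x_1,\dots,x_n\in F$. Finally $B_q$ is the smallest $B\in(0,\infty)$ such that $\|\sum_{j=1}^nr_ja_j\|_{L_q(\widetilde\Omega;\mathbb R)}\le B(\sum_{j=1}^na_j^2)^{1/2}$ for all Rademacher families, all $n$ and all $a_1,\dots,a_n\in\mathbb R$. Set $$C^{\mathsf{SL}}_{q,p,k}:=2\bigl(2k\,K_{q,p}\,\tau_p(E)+B_q\bigr).$$ **Corollary (single-level Monte Carlo).** Assume that $E$ is of Rademacher type $p\in[1,2]$. Let $q\in[p,\infty)$, $k,M\in\mathbb N$, and let $\xi_1,\dots,\xi_M\in L_{kq}(\Omega;E)$ be independent and identically distributed $E$-valued random variables. Then, for every $U\in\otimes^{k,s}_{\varepsilon_s}E$, the random variable $U-\frac1M\sum_{j=1}^M\otimes^k\xi_j$ belongs to $L_q(\Omega;\otimes^{k,s}_{\varepsilon_s}E)$ and $$\Bigl\|U-\frac1M\sum_{j=1}^M\otimes^k\xi_j\Bigr\|_{L_q(\Omega;\otimes^{k,s}_{\varepsilon_s}E)}\le\bigl\|U-\mathbb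 M^k_\varepsilon[\xi_1]\bigr\|_{\varepsilon_s}+C^{\mathsf{SL}}_{q,p,k}\,M^{-(1-\frac1p)}\,\|\xi_1\|^k_{L_{kq}(\Omega;E)}.$$ In particular, for all $\eta\in L_k(\Omega;E)$, $$\bigl\|\mathbb M^k_\varepsilon[\eta]-\mathbb M^k_\varepsilon[\xi_1]\bigr\|_{\varepsilon_s}\le\|\eta-\xi_1\|_{L_k(\Omega;E)}\sum_{i=0}^{k-1}\|\eta\|^i_{L_k(\Omega;E)}\|\xi_1\|^{k-i-1}_{L_k(\Omega;E)}$$ and $$\Bigl\|\mathbb M^k_\varepsilon[\eta]-\frac1M\sum_{j=1}^M\otimes^k\xi_j\Bigr\|_{L_q(\Omega;\otimes^{k,s}_{\varepsilon_s}E)}\le\|\eta-\xi_1\|_{L_k(\Omega;E)}\sum_{i=0}^{k-1}\|\eta\|^i_{L_k(\Omega;E)}\|\xi_1\|^{k-i-1}_{L_k(\Omega;E)}+C^{\mathsf{SL}}_{q,p,k}\,M^{-(1-\frac1p)}\,\|\xi_1\|^k_{L_{kq}(\Omega;E)}.$$ -/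

import Mathlib

open MeasureTheory ProbabilityTheory
open scoped TensorProduct ENNReal

namespace MonteCarloMoments

noncomputable section

/-! ### Algebraic tensor products and the injective norms -/

section Tensor

variable (k : ℕ) (E : Type*) [NormedAddCommGroup E] [NormedSpace ℝ E]

/-- The `k`-fold algebraic tensor product of `E`. It is a type synonym of
`⨂[ℝ] _ : Fin k, E`, which carries the injective norm instead of Mathlib's projective one. -/
def AlgTensor : Type _ := ⨂[ℝ] _ : Fin k, E

instance : AddCommGroup (AlgTensor k E) := inferInstanceAs (AddCommGroup (⨂[ℝ] _ : Fin k, E))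

instance : Module ℝ (AlgTensor k E) := inferInstanceAs (Module ℝ (⨂[ℝ] _ : Fin k, E))

/-- The elementary tensor `x₁ ⊗ ⋯ ⊗ xₖ`, as a multilinear map of `(x₁, …, xₖ)`. -/
def elemTensor : MultilinearMap ℝ (fun _ : Fin k => E) (AlgTensor k E) :=
  PiTensorProduct.tprod ℝ

variable {k E}

/-- The linear functional `f₁ ⊗ ⋯ ⊗ fₖ` on the algebraic tensor product. -/
def tensorEval (f : Fin k → StrongDual ℝ E) : AlgTensor k E →ₗ[ℝ] ℝ :=
  PiTensorProduct.lift
    ((MultilinearMap.mkPiAlgebra ℝ (Fin k) ℝ).compLinearMap fun n => (f n : E →ₗ[ℝ] ℝ))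

theorem tensorEval_elemTensor (f : Fin k → StrongDual ℝ E) (x : Fin k → E) :
    tensorEval f (elemTensor k E x) = ∏ n, f n (x n) := by
  have h := PiTensorProduct.lift.tprod (R := ℝ)
    (φ := (MultilinearMap.mkPiAlgebra ℝ (Fin k) ℝ).compLinearMap
      fun n => (f n : E →ₗ[ℝ] ℝ)) x
  refine h.trans ?_
  simp

theorem algTensor_induction {motive : AlgTensor k E → Prop}
    (smul : ∀ (c : ℝ) (x : Fin k → E), motive (c • elemTensor k E x))
    (add : ∀ U V, motive U → motive V → motive (U + V)) (U : AlgTensor k E) : motive U :=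
  PiTensorProduct.induction_on U smul add

theorem exists_abs_tensorEval_le (U : AlgTensor k E) :
    ∃ C : ℝ, ∀ f : Fin k → Metric.closedBall (0 : StrongDual ℝ E) 1,
      |tensorEval (fun n => (f n : StrongDual ℝ E)) U| ≤ C := by
  refine algTensor_induction
    (motive := fun U => ∃ C : ℝ, ∀ f : Fin k → Metric.closedBall (0 : StrongDual ℝ E) 1,
      |tensorEval (fun n => (f n : StrongDual ℝ E)) U| ≤ C) ?_ ?_ U
  · intro c x
    refine ⟨|c| * ∏ n, ‖x n‖, fun f => ?_⟩
    rw [map_smul, smul_eq_mul, abs_mul, tensorEval_elemTensor, Finset.abs_prod]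
    refine mul_le_mul_of_nonneg_left ?_ (abs_nonneg c)
    refine Finset.prod_le_prod (fun _ _ => abs_nonneg _) fun n _ => ?_
    have h : ‖(f n : StrongDual ℝ E)‖ ≤ 1 := mem_closedBall_zero_iff.mp (f n).2
    calc |(f n : StrongDual ℝ E) (x n)| ≤ ‖(f n : StrongDual ℝ E)‖ * ‖x n‖ :=
          (f n : StrongDual ℝ E).le_opNorm (x n)
      _ ≤ 1 * ‖x n‖ := mul_le_mul_of_nonneg_right h (norm_nonneg _)
      _ = ‖x n‖ := one_mul _
  · rintro U V ⟨C, hC⟩ ⟨D, hD⟩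
    refine ⟨C + D, fun f => ?_⟩
    rw [map_add]
    exact (abs_add_le _ _).trans (add_le_add (hC f) (hD f))

/-- The injective tensor norm: the supremum of `|(f₁ ⊗ ⋯ ⊗ fₖ) U|` over functionals
`f₁, …, fₖ` in the closed unit ball of the dual space. -/
instance : Norm (AlgTensor k E) where
  norm U := ⨆ f : Fin k → Metric.closedBall (0 : StrongDual ℝ E) 1,
    |tensorEval (fun n => (f n : StrongDual ℝ E)) U|

theorem algTensor_norm_def (U : AlgTensor k E) :
    ‖U‖ = ⨆ f : Fin k → Metric.closedBall (0 : StrongDual ℝ E) 1,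
      |tensorEval (fun n => (f n : StrongDual ℝ E)) U| := rfl

theorem abs_tensorEval_le_norm (U : AlgTensor k E)
    (f : Fin k → Metric.closedBall (0 : StrongDual ℝ E) 1) :
    |tensorEval (fun n => (f n : StrongDual ℝ E)) U| ≤ ‖U‖ := by
  obtain ⟨C, hC⟩ := exists_abs_tensorEval_le U
  exact le_ciSup (f := fun f : Fin k → Metric.closedBall (0 : StrongDual ℝ E) 1 =>
    |tensorEval (fun n => (f n : StrongDual ℝ E)) U|) ⟨C, by rintro _ ⟨g, rfl⟩; exact hC g⟩ f

instance : Nonempty (Metric.closedBall (0 : StrongDual ℝ E) 1) := ⟨⟨0, by simp⟩⟩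

theorem algTensor_core : SeminormedSpace.Core ℝ (AlgTensor k E) where
  norm_nonneg U := Real.iSup_nonneg fun _ => abs_nonneg _
  norm_smul c U := by
    simp only [algTensor_norm_def, map_smul, smul_eq_mul, abs_mul, Real.norm_eq_abs]
    exact (Real.mul_iSup_of_nonneg (abs_nonneg c) _).symm
  norm_triangle U V := by
    refine ciSup_le fun f => ?_
    rw [map_add]
    exact (abs_add_le _ _).trans
      (add_le_add (abs_tensorEval_le_norm U f) (abs_tensorEval_le_norm V f))

instance : SeminormedAddCommGroup (AlgTensor k E) := SeminormedAddCommGroup.ofCore algTensor_core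

instance : NormedSpace ℝ (AlgTensor k E) where
  norm_smul_le c U := (algTensor_core.norm_smul c U).le

variable (k E)

/-- The (full) `k`-fold injective tensor product of `E`: the completion of the algebraic tensor
product with respect to the injective norm. -/
abbrev InjTensor : Type _ := UniformSpace.Completion (AlgTensor k E)

/-- The symmetrization
`s(x₁ ⊗ ⋯ ⊗ xₖ) = (1 / k!) ∑_σ x_{σ(1)} ⊗ ⋯ ⊗ x_{σ(k)}`, extended linearly. -/
def symmetrize : AlgTensor k E →ₗ[ℝ] AlgTensor k E :=
  PiTensorProduct.lift
    ((k.factorial : ℝ)⁻¹ • ∑ σ : Equiv.Perm (Fin k), (elemTensor k E).domDomCongr σ)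

variable {k E} in
theorem symmetrize_elemTensor (x : Fin k → E) :
    symmetrize k E (elemTensor k E x)
      = (k.factorial : ℝ)⁻¹ •
          ∑ σ : Equiv.Perm (Fin k), elemTensor k E (fun n => x (σ n)) := by
  have h := PiTensorProduct.lift.tprod (R := ℝ)
    (φ := (k.factorial : ℝ)⁻¹ • ∑ σ : Equiv.Perm (Fin k), (elemTensor k E).domDomCongr σ) x
  refine h.trans ?_
  simp

/-- The `k`-fold symmetric algebraic tensor product of `E`: the linear span of all
symmetrizations `s(x₁ ⊗ ⋯ ⊗ xₖ)`. -/
def symSubmodule : Submodule ℝ (AlgTensor k E) :=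
  Submodule.span ℝ (Set.range fun x : Fin k → E => symmetrize k E (elemTensor k E x))

/-- The `k`-fold symmetric algebraic tensor product as a type of its own; it carries the symmetric
injective norm instead of the norm inherited from `AlgTensor k E`. -/
def SymAlgTensor : Type _ := symSubmodule k E

instance : AddCommGroup (SymAlgTensor k E) := inferInstanceAs (AddCommGroup (symSubmodule k E))

instance : Module ℝ (SymAlgTensor k E) := inferInstanceAs (Module ℝ (symSubmodule k E))

/-- The inclusion of the symmetric into the full algebraic tensor product. -/
def symInclusion : SymAlgTensor k E →ₗ[ℝ] AlgTensor k E := (symSubmodule k E).subtype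

variable {k E}

/-- The symmetric injective tensor norm: the supremum of `|(f ⊗ ⋯ ⊗ f) U|` over `f` in the closed
unit ball of the dual space. For `U = ∑ⱼ λⱼ xⱼ ⊗ ⋯ ⊗ xⱼ` one has
`(f ⊗ ⋯ ⊗ f) U = ∑ⱼ λⱼ f(xⱼ) ^ k`. -/
instance : Norm (SymAlgTensor k E) where
  norm U := ⨆ f : Metric.closedBall (0 : StrongDual ℝ E) 1,
    |tensorEval (fun _ => (f : StrongDual ℝ E)) (symInclusion k E U)|

theorem symAlgTensor_norm_def (U : SymAlgTensor k E) :
    ‖U‖ = ⨆ f : Metric.closedBall (0 : StrongDual ℝ E) 1,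
      |tensorEval (fun _ => (f : StrongDual ℝ E)) (symInclusion k E U)| := rfl

theorem abs_tensorEval_le_symNorm (U : SymAlgTensor k E)
    (f : Metric.closedBall (0 : StrongDual ℝ E) 1) :
    |tensorEval (fun _ => (f : StrongDual ℝ E)) (symInclusion k E U)| ≤ ‖U‖ := by
  obtain ⟨C, hC⟩ := exists_abs_tensorEval_le (symInclusion k E U)
  exact le_ciSup (f := fun f : Metric.closedBall (0 : StrongDual ℝ E) 1 =>
    |tensorEval (fun _ => (f : StrongDual ℝ E)) (symInclusion k E U)|)
    ⟨C, by rintro _ ⟨g, rfl⟩; exact hC fun _ => g⟩ f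

theorem symAlgTensor_core : SeminormedSpace.Core ℝ (SymAlgTensor k E) where
  norm_nonneg U := Real.iSup_nonneg fun _ => abs_nonneg _
  norm_smul c U := by
    simp only [symAlgTensor_norm_def, map_smul, smul_eq_mul, abs_mul, Real.norm_eq_abs]
    exact (Real.mul_iSup_of_nonneg (abs_nonneg c) _).symm
  norm_triangle U V := by
    refine ciSup_le fun f => ?_
    rw [map_add, map_add]
    exact (abs_add_le _ _).trans
      (add_le_add (abs_tensorEval_le_symNorm U f) (abs_tensorEval_le_symNorm V f))

instance : SeminormedAddCommGroup (SymAlgTensor k E) :=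
  SeminormedAddCommGroup.ofCore symAlgTensor_core

instance : NormedSpace ℝ (SymAlgTensor k E) where
  norm_smul_le c U := (symAlgTensor_core.norm_smul c U).le

variable (k E)

/-- The `k`-fold symmetric injective tensor product of `E`: the completion of the symmetric
algebraic tensor product with respect to the symmetric injective norm. -/
abbrev SymInjTensor : Type _ := UniformSpace.Completion (SymAlgTensor k E)

variable {k E}

theorem symmetrize_mem (U : AlgTensor k E) : symmetrize k E U ∈ symSubmodule k E := by
  refine algTensor_induction (motive := fun U => symmetrize k E U ∈ symSubmodule k E) ?_ ?_ U
  · intro c x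
    rw [map_smul]
    exact Submodule.smul_mem _ _ (Submodule.subset_span ⟨x, rfl⟩)
  · intro U V hU hV
    rw [map_add]
    exact Submodule.add_mem _ hU hV

/-- On symmetric functionals the symmetrization is invisible. -/
theorem tensorEval_symmetrize (f : StrongDual ℝ E) (U : AlgTensor k E) :
    tensorEval (fun _ => f) (symmetrize k E U) = tensorEval (fun _ => f) U := by
  refine algTensor_induction
    (motive := fun U => tensorEval (fun _ => f) (symmetrize k E U) = tensorEval (fun _ => f) U)
    ?_ ?_ U
  · intro c x
    have hk : (k.factorial : ℝ) ≠ 0 := by exact_mod_cast k.factorial_ne_zero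
    have h : ∀ σ : Equiv.Perm (Fin k), ∏ n, f (x (σ n)) = ∏ n, f (x n) := fun σ =>
      Equiv.prod_comp σ fun n => f (x n)
    rw [map_smul, map_smul, map_smul, symmetrize_elemTensor, map_smul, map_sum]
    simp only [tensorEval_elemTensor, h, Finset.sum_const, Finset.card_univ, Fintype.card_perm,
      Fintype.card_fin, nsmul_eq_mul, smul_eq_mul]
    rw [inv_mul_cancel_left₀ hk]
  · intro U V hU hV
    rw [map_add, map_add, map_add, hU, hV]

variable (k E) in
/-- The symmetrization as a linear map onto the symmetric algebraic tensor product. -/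
def symProjAlg : AlgTensor k E →ₗ[ℝ] SymAlgTensor k E :=
  (symmetrize k E).codRestrict (symSubmodule k E) symmetrize_mem

theorem norm_symProjAlg_le (U : AlgTensor k E) : ‖symProjAlg k E U‖ ≤ 1 * ‖U‖ := by
  rw [one_mul]
  refine ciSup_le fun f => ?_
  have h : symInclusion k E (symProjAlg k E U) = symmetrize k E U := rfl
  rw [h, tensorEval_symmetrize]
  exact abs_tensorEval_le_norm U fun _ => f

variable (k E) in
/-- The continuous extension of the symmetrization to a linear map from the full onto the symmetric
injective tensor product. -/
def symProj : InjTensor k E →L[ℝ] SymInjTensor k E :=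
  ((symProjAlg k E).mkContinuous 1 norm_symProjAlg_le).completion

variable (k) in
/-- The `k`-fold tensor power `x ⊗ ⋯ ⊗ x` as an element of the full injective tensor product. -/
def tensorPow (x : E) : InjTensor k E := ((elemTensor k E fun _ => x : AlgTensor k E) : InjTensor k E)

theorem elemTensor_diag_mem (x : E) : (elemTensor k E fun _ => x) ∈ symSubmodule k E := by
  have hk : (k.factorial : ℝ) ≠ 0 := by exact_mod_cast k.factorial_ne_zero
  refine Submodule.subset_span ⟨fun _ => x, ?_⟩
  simp only [symmetrize_elemTensor, Finset.sum_const, Finset.card_univ, Fintype.card_perm,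
    Fintype.card_fin]
  rw [← Nat.cast_smul_eq_nsmul ℝ, smul_smul, inv_mul_cancel₀ hk, one_smul]

variable (k) in
/-- The `k`-fold tensor power `x ⊗ ⋯ ⊗ x` as an element of the symmetric algebraic tensor
product. -/
def symElemPow (x : E) : SymAlgTensor k E := ⟨elemTensor k E fun _ => x, elemTensor_diag_mem x⟩

variable (k) in
/-- The `k`-fold tensor power `x ⊗ ⋯ ⊗ x` as an element of the symmetric injective tensor
product. -/
def symTensorPow (x : E) : SymInjTensor k E := (symElemPow k x : SymInjTensor k E)

theorem symProj_tensorPow (x : E) : symProj k E (tensorPow k x) = symTensorPow k x := by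
  have hk : (k.factorial : ℝ) ≠ 0 := by exact_mod_cast k.factorial_ne_zero
  have h : symProjAlg k E (elemTensor k E fun _ => x) = symElemPow k x := by
    refine Subtype.ext ?_
    change symmetrize k E (elemTensor k E fun _ => x) = elemTensor k E fun _ => x
    simp only [symmetrize_elemTensor, Finset.sum_const, Finset.card_univ, Fintype.card_perm,
      Fintype.card_fin]
    rw [← Nat.cast_smul_eq_nsmul ℝ, smul_smul, inv_mul_cancel₀ hk, one_smul]
  have h2 := ContinuousLinearMap.completion_apply_coe
    ((symProjAlg k E).mkContinuous 1 norm_symProjAlg_le) (elemTensor k E fun _ => x)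
  refine h2.trans ?_
  rw [LinearMap.mkContinuous_apply, h]
  rfl

end Tensor

/-! ### Moments -/

section Moments

variable {Ω : Type*} [MeasurableSpace Ω] {E : Type*} [NormedAddCommGroup E] [NormedSpace ℝ E]

/-- The injective `k`-th moment of `ξ`: the Bochner integral of `ξ ⊗ ⋯ ⊗ ξ` in the full injective
tensor product. -/
def injMoment (k : ℕ) (ξ : Ω → E) (P : Measure Ω) : InjTensor k E :=
  ∫ ω, tensorPow k (ξ ω) ∂P

/-- The injective `k`-th moment, regarded as an element of the symmetric injective tensor product
by means of the symmetrization (which leaves it unchanged). -/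
def symMoment (k : ℕ) (ξ : Ω → E) (P : Measure Ω) : SymInjTensor k E :=
  symProj k E (injMoment k ξ P)

end Moments

/-! ### Rademacher families and the constants

The constants below are infima of sets of admissible constants. Rademacher families are taken on
probability spaces in `Type`; the distribution of `∑ⱼ rⱼ xⱼ` does not depend on the probability
space, so this is no restriction. -/

/-- A sequence of independent random signs, each equal to `1` or `-1` with probability `1 / 2`. -/
structure IsRademacherFamily {Ω : Type*} [MeasurableSpace Ω] (P : Measure Ω) (r : ℕ → Ω → ℝ) :
    Prop where
  measurable : ∀ j, Measurable (r j)
  eq_or_eq : ∀ j ω, r j ω = -1 ∨ r j ω = 1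
  measure_neg_one : ∀ j, P {ω | r j ω = -1} = 1 / 2
  measure_one : ∀ j, P {ω | r j ω = 1} = 1 / 2
  indep : iIndepFun r P

/-- `τ` is admissible in the type `p` inequality of the space `F`. -/
def IsTypeConstant (F : Type*) [NormedAddCommGroup F] [NormedSpace ℝ F] (p τ : ℝ) : Prop :=
  0 < τ ∧ ∀ (Ω : Type) [MeasurableSpace Ω] (P : Measure Ω) [IsProbabilityMeasure P] [P.IsComplete]
    (r : ℕ → Ω → ℝ), IsRademacherFamily P r → ∀ (n : ℕ) (x : Fin n → F),
      lpNorm (fun ω => ∑ j : Fin n, r j ω • x j) (ENNReal.ofReal p) P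
        ≤ τ * (∑ j : Fin n, ‖x j‖ ^ p) ^ (1 / p)

/-- `F` has Rademacher type `p`. -/
def HasRademacherType (F : Type*) [NormedAddCommGroup F] [NormedSpace ℝ F] (p : ℝ) : Prop :=
  ∃ τ : ℝ, IsTypeConstant F p τ

/-- The type `p` constant `τ_p(F)`. -/
def typeConstant (F : Type*) [NormedAddCommGroup F] [NormedSpace ℝ F] (p : ℝ) : ℝ :=
  sInf {τ : ℝ | IsTypeConstant F p τ}

universe u

/-- The `(q, p)` Kahane–Khintchine constant: the smallest `K` such that
`‖∑ⱼ rⱼ xⱼ‖_{L_q} ≤ K ‖∑ⱼ rⱼ xⱼ‖_{L_p}` for all Banach spaces, all finite families of vectors and all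
Rademacher families. (Only the finite-dimensional span of the vectors matters, so the value does not
depend on the universe of the Banach spaces.) -/
def kahaneKhintchineConstant (q p : ℝ) : ℝ :=
  sInf {K : ℝ | 0 < K ∧ ∀ (Ω : Type) [MeasurableSpace Ω] (P : Measure Ω) [IsProbabilityMeasure P]
    [P.IsComplete] (r : ℕ → Ω → ℝ), IsRademacherFamily P r →
    ∀ (F : Type u) [NormedAddCommGroup F] [NormedSpace ℝ F] [CompleteSpace F]
      (n : ℕ) (x : Fin n → F),
      lpNorm (fun ω => ∑ j : Fin n, r j ω • x j) (ENNReal.ofReal q) P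
        ≤ K * lpNorm (fun ω => ∑ j : Fin n, r j ω • x j) (ENNReal.ofReal p) P}

/-- The constant `B_q` of the classical Khintchine inequality: the smallest `B` such that
`‖∑ⱼ rⱼ aⱼ‖_{L_q} ≤ B (∑ⱼ aⱼ²)^{1/2}` for all finite families of reals and all Rademacher
families. -/
def khintchineConstant (q : ℝ) : ℝ :=
  sInf {B : ℝ | 0 < B ∧ ∀ (Ω : Type) [MeasurableSpace Ω] (P : Measure Ω) [IsProbabilityMeasure P]
    [P.IsComplete] (r : ℕ → Ω → ℝ), IsRademacherFamily P r → ∀ (n : ℕ) (a : Fin n → ℝ),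
      lpNorm (fun ω => ∑ j : Fin n, r j ω * a j) (ENNReal.ofReal q) P
        ≤ B * (∑ j : Fin n, a j ^ 2) ^ (1 / 2 : ℝ)}

/-- The single-level constant `2 (2 k K_{q,p} τ_p(E) + B_q)`. -/
def singleLevelConstant (E : Type u) [NormedAddCommGroup E] [NormedSpace ℝ E] (q p : ℝ) (k : ℕ) :
    ℝ :=
  2 * (2 * k * kahaneKhintchineConstant.{u} q p * typeConstant E p + khintchineConstant q)

end

end MonteCarloMoments

open MonteCarloMoments

/-!
Comparing the centred sum of the tensor powers `⊗ᵏξⱼ` with an independent copy, and exchanging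
some of the coordinates with those of the copy, bounds it in `L_q` by twice the sum with arbitrary
signs. The supremum over the dual unit ball that defines the norm of that sum is then a supremum
of `∑ⱼ εⱼ f(ξⱼ)ᵏ`. Since `t ↦ tᵏ` is `k R^(k-1)`-Lipschitz on `[-R, R]`, the contraction principle
for suprema of Rademacher sums replaces it, at the cost of a factor `2k`, by the norm of the
linear sum `∑ⱼ εⱼ ‖ξⱼ‖^(k-1) ξⱼ` in `E`, to which the Kahane-Khintchine inequality and the
Rademacher type of `E` apply. That the Kahane-Khintchine constant is finite follows from Bonami's
hypercontractivity on the discrete cube: the norm of a Rademacher sum is subharmonic for the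
noise operator, so the scalar inequality suffices.

Centring by a copy, instead of at each `f`, does not produce the term with `B_q`, which is thus
only slack in `C^SL_{q,p,k}`.
-/

namespace MonteCarloMoments

open BoundedContinuousFunction
open scoped BigOperators Topology

noncomputable section

universe u

variable {n : ℕ}

section Signs

theorem sum_signs_succ (Φ : (Fin (n + 1) → ℤˣ) → ℝ) :
    ∑ ε, Φ ε = ∑ ε : Fin n → ℤˣ, (Φ (Fin.cons 1 ε) + Φ (Fin.cons (-1) ε)) := by
  rw [← (Fin.consEquiv fun _ : Fin (n + 1) => ℤˣ).sum_comp, Fintype.sum_prod_type_right]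
  refine Finset.sum_congr rfl fun ε _ => ?_
  rw [UnitsInt.univ, Finset.sum_pair (by decide)]
  rfl

theorem expect_signs_succ (Φ : (Fin (n + 1) → ℤˣ) → ℝ) :
    𝔼 ε, Φ ε = 𝔼 ε : Fin n → ℤˣ, (Φ (Fin.cons 1 ε) + Φ (Fin.cons (-1) ε)) / 2 := by
  simp only [Fintype.expect_eq_sum_div_card, sum_signs_succ Φ, ← Finset.sum_div, Fintype.card_pi,
    Finset.prod_const, Finset.card_univ, Fintype.card_fin, Fintype.card_units_int, pow_succ]
  push_cast
  rw [div_div, mul_comm]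

end Signs

section Contraction

theorem add_le_add_of_weakly_majorized {G : ℝ → ℝ} (hconv : ConvexOn ℝ Set.univ G)
    (hmono : Monotone G) {a b c d : ℝ} (hmax : max a b ≤ max c d) (hsum : a + b ≤ c + d) :
    G a + G b ≤ G c + G d := by
  wlog hab : b ≤ a generalizing a b
  · rw [add_comm (G a)]
    exact this (by rwa [max_comm]) (by rwa [add_comm]) (le_of_not_ge hab)
  wlog hcd : d ≤ c generalizing c d
  · rw [add_comm (G c)]
    exact this (by rwa [max_comm d]) (by rwa [add_comm d]) (le_of_not_ge hcd)
  rw [max_eq_left hab, max_eq_left hcd] at hmax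
  rcases le_total b d with hbd | hdb
  · exact add_le_add (hmono hmax) (hmono hbd)
  have hspread : G a + G (c + d - a) ≤ G c + G d := by
    obtain ⟨s, t, hs, ht, hst, rfl⟩ : a ∈ segment ℝ c d := by
      rw [segment_symm, segment_eq_Icc hcd]
      exact ⟨hdb.trans hab, hmax⟩
    have hswap : c + d - (s • c + t • d) = t • c + s • d := by
      simp only [smul_eq_mul]
      linear_combination -(c + d) * hst
    have hs_comb := hconv.2 (Set.mem_univ c) (Set.mem_univ d) hs ht hst
    have ht_comb := hconv.2 (Set.mem_univ c) (Set.mem_univ d) ht hs (add_comm t s ▸ hst)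
    rw [hswap]
    simp only [smul_eq_mul] at hs_comb ht_comb ⊢
    linear_combination hs_comb + ht_comb + (G c + G d) * hst
  exact (add_le_add_right (hmono (by linarith)) (G a)).trans hspread

variable {T : Type*} [TopologicalSpace T] [Nonempty T]

theorem add_iSup_le_add_iSup_of_contraction {G : ℝ → ℝ} (hconv : ConvexOn ℝ Set.univ G)
    (hmono : Monotone G) (h : T →ᵇ ℝ) {v w : T →ᵇ ℝ} (hle : ∀ t, |v t| ≤ |w t|)
    (hlip : ∀ s t, |v s - v t| ≤ |w s - w t|) :
    G (⨆ t, (h + v) t) + G (⨆ t, (h - v) t) ≤ G (⨆ t, (h + w) t) + G (⨆ t, (h - w) t) := by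
  have le_add (t : T) : h t + w t ≤ ⨆ t, (h + w) t :=
    le_ciSup (h + w).isBounded_range.bddAbove t
  have le_sub (t : T) : h t - w t ≤ ⨆ t, (h - w) t :=
    le_ciSup (h - w).isBounded_range.bddAbove t
  have add_abs_le (t : T) : h t + |w t| ≤ max (⨆ t, (h + w) t) (⨆ t, (h - w) t) := by
    rcases abs_choice (w t) with hw | hw <;> rw [hw]
    · exact (le_add t).trans (le_max_left _ _)
    · exact (le_sub t).trans (le_max_right _ _)
  refine add_le_add_of_weakly_majorized hconv hmono
    (max_le (ciSup_le fun t => ?_) (ciSup_le fun t => ?_)) ?_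
  · exact (add_le_add_right ((le_abs_self _).trans (hle t)) _).trans (add_abs_le t)
  · exact (add_le_add_right ((neg_le_abs _).trans (hle t)) _).trans (add_abs_le t)
  · refine ciSup_add_ciSup_le fun s t => ?_
    have hst := (le_abs_self _).trans (hlip s t)
    change h s + v s + (h t - v t) ≤ _
    rcases abs_choice (w s - w t) with hw | hw <;> rw [hw] at hst
    · linarith [le_add s, le_sub t]
    · linarith [le_add t, le_sub s]

theorem expect_iSup_contraction {G : ℝ → ℝ} (hconv : ConvexOn ℝ Set.univ G) (hmono : Monotone G)
    (h : T →ᵇ ℝ) {v w : Fin n → T →ᵇ ℝ} (hle : ∀ i t, |v i t| ≤ |w i t|)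
    (hlip : ∀ i s t, |v i s - v i t| ≤ |w i s - w i t|) :
    𝔼 ε : Fin n → ℤˣ, G (⨆ t, (h + ∑ i, ε i • v i) t)
      ≤ 𝔼 ε : Fin n → ℤˣ, G (⨆ t, (h + ∑ i, ε i • w i) t) := by
  induction n generalizing h with
  | zero => simp
  | succ n ih =>
    simp only [expect_signs_succ, Fin.sum_univ_succ, Fin.cons_zero, Fin.cons_succ, one_smul,
      Units.neg_smul, ← add_assoc, ← sub_eq_add_neg, ← Finset.expect_div,
      Finset.expect_add_distrib]
    set tailSum : (Fin n → ℤˣ) → T →ᵇ ℝ := fun ε => ∑ i, ε i • w i.succ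
    calc (𝔼 ε : Fin n → ℤˣ, G (⨆ t, (h + v 0 + ∑ i, ε i • v i.succ) t)
          + 𝔼 ε : Fin n → ℤˣ, G (⨆ t, (h - v 0 + ∑ i, ε i • v i.succ) t)) / 2
        ≤ (𝔼 ε, G (⨆ t, (h + v 0 + tailSum ε) t) + 𝔼 ε, G (⨆ t, (h - v 0 + tailSum ε) t)) / 2 := by
          have htail (c : T →ᵇ ℝ) := ih c (fun i => hle i.succ) fun i => hlip i.succ
          exact div_le_div_of_nonneg_right (add_le_add (htail _) (htail _)) two_pos.le
      _ = (𝔼 ε, (G (⨆ t, (h + tailSum ε + v 0) t) + G (⨆ t, (h + tailSum ε - v 0) t))) / 2 := by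
          simp only [Finset.expect_add_distrib, add_right_comm h (v 0), sub_add_eq_add_sub]
      _ ≤ (𝔼 ε, (G (⨆ t, (h + tailSum ε + w 0) t) + G (⨆ t, (h + tailSum ε - w 0) t))) / 2 := by
          refine div_le_div_of_nonneg_right (Finset.expect_le_expect fun ε _ => ?_) two_pos.le
          exact add_iSup_le_add_iSup_of_contraction hconv hmono _ (hle 0) (hlip 0)
      _ = (𝔼 ε, G (⨆ t, (h + w 0 + tailSum ε) t) + 𝔼 ε, G (⨆ t, (h - w 0 + tailSum ε) t)) / 2 := by
          simp only [Finset.expect_add_distrib, add_right_comm h (w 0), sub_add_eq_add_sub]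

theorem norm_rpow_le_iSup_add_iSup_neg (f : T →ᵇ ℝ) {q : ℝ} (hq : 0 < q) :
    ‖f‖ ^ q ≤ max (⨆ t, f t) 0 ^ q + max (⨆ t, (-f) t) 0 ^ q := by
  have hnorm : ‖f‖ ≤ max (max (⨆ t, f t) 0) (max (⨆ t, (-f) t) 0) := by
    refine norm_le_of_nonempty.2 fun t => abs_le'.2 ⟨?_, ?_⟩
    · exact le_max_of_le_left (le_max_of_le_left (le_ciSup f.isBounded_range.bddAbove t))
    · exact le_max_of_le_right (le_max_of_le_left (le_ciSup (-f).isBounded_range.bddAbove t))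
  have hpos (x : ℝ) : 0 ≤ max x 0 ^ q := by positivity
  refine (Real.rpow_le_rpow (norm_nonneg f) hnorm hq.le).trans ?_
  rcases max_choice (max (⨆ t, f t) 0) (max (⨆ t, (-f) t) 0) with hmax | hmax <;> rw [hmax]
  · exact le_add_of_nonneg_right (hpos _)
  · exact le_add_of_nonneg_left (hpos _)

theorem convexOn_max_zero_rpow {q : ℝ} (hq : 1 ≤ q) :
    ConvexOn ℝ Set.univ fun x : ℝ => max x 0 ^ q := by
  have hconv : ConvexOn ℝ Set.univ fun x : ℝ => max x 0 :=
    (convexOn_id convex_univ).sup (convexOn_const 0 convex_univ)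
  refine ⟨convex_univ, fun x _ y _ a b ha hb hab => ?_⟩
  have hle := hconv.2 (Set.mem_univ x) (Set.mem_univ y) ha hb hab
  exact (Real.rpow_le_rpow (le_max_right _ _) hle (by linarith)).trans
    ((convexOn_rpow hq).2 (le_max_right x 0) (le_max_right y 0) ha hb hab)

theorem monotone_max_zero_rpow {q : ℝ} (hq : 0 ≤ q) : Monotone fun x : ℝ => max x 0 ^ q :=
  fun x _ hxy => Real.rpow_le_rpow (le_max_right x 0) (max_le_max_right 0 hxy) hq

theorem expect_norm_rpow_contraction {q : ℝ} (hq : 1 ≤ q) {v w : Fin n → T →ᵇ ℝ}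
    (hle : ∀ i t, |v i t| ≤ |w i t|) (hlip : ∀ i s t, |v i s - v i t| ≤ |w i s - w i t|) :
    𝔼 ε : Fin n → ℤˣ, ‖∑ i, ε i • v i‖ ^ q ≤ 2 * 𝔼 ε : Fin n → ℤˣ, ‖∑ i, ε i • w i‖ ^ q := by
  set G : ℝ → ℝ := fun x => max x 0 ^ q
  have hneg : 𝔼 ε : Fin n → ℤˣ, G (⨆ t, (-∑ i, ε i • v i) t)
      = 𝔼 ε : Fin n → ℤˣ, G (⨆ t, (∑ i, ε i • v i) t) :=
    Fintype.expect_equiv (Equiv.neg _) _ _ fun ε => by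
      simp only [Equiv.neg_apply, Pi.neg_apply, Units.neg_smul, Finset.sum_neg_distrib]
  calc 𝔼 ε : Fin n → ℤˣ, ‖∑ i, ε i • v i‖ ^ q
      ≤ 𝔼 ε : Fin n → ℤˣ, (G (⨆ t, (∑ i, ε i • v i) t) + G (⨆ t, (-∑ i, ε i • v i) t)) :=
        Finset.expect_le_expect fun ε _ => norm_rpow_le_iSup_add_iSup_neg _ (by linarith)
    _ = 2 * 𝔼 ε : Fin n → ℤˣ, G (⨆ t, (∑ i, ε i • v i) t) := by
        rw [Finset.expect_add_distrib, hneg, two_mul]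
    _ ≤ 2 * 𝔼 ε : Fin n → ℤˣ, G (⨆ t, (∑ i, ε i • w i) t) := by
        have hsup := expect_iSup_contraction (convexOn_max_zero_rpow hq)
          (monotone_max_zero_rpow (by linarith)) 0 hle hlip
        simp only [zero_add] at hsup
        exact mul_le_mul_of_nonneg_left hsup two_pos.le
    _ ≤ 2 * 𝔼 ε : Fin n → ℤˣ, ‖∑ i, ε i • w i‖ ^ q := by
        gcongr with ε
        refine Real.rpow_le_rpow (le_max_right _ _) (max_le (ciSup_le fun t => ?_) (norm_nonneg _))
          (by linarith)
        exact (le_abs_self _).trans (norm_coe_le_norm (∑ i, ε i • w i) t)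

end Contraction

section Noise

/-- The noise operator `T_ρ` of the discrete cube, which replaces each sign by an independent
fair sign with probability `1 - ρ`, written with its product kernel. -/
def noise (ρ : ℝ) : ((Fin n → ℤˣ) → ℝ) →ₗ[ℝ] (Fin n → ℤˣ) → ℝ :=
  Matrix.mulVecLin (Matrix.of fun ε δ => ∏ j, (1 + ρ * (ε j * δ j : ℤˣ)) / 2)

theorem noise_apply (ρ : ℝ) (Φ : (Fin n → ℤˣ) → ℝ) (ε : Fin n → ℤˣ) :
    noise ρ Φ ε = ∑ δ, (∏ j, (1 + ρ * (ε j * δ j : ℤˣ)) / 2) * Φ δ :=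
  rfl

theorem noise_fin_zero (ρ : ℝ) (Φ : (Fin 0 → ℤˣ) → ℝ) (ε : Fin 0 → ℤˣ) : noise ρ Φ ε = Φ ε := by
  rw [noise_apply, Fintype.sum_unique, Fin.prod_univ_zero, one_mul]
  exact congrArg Φ (Subsingleton.elim _ _)

theorem noise_cons (ρ : ℝ) (Φ : (Fin (n + 1) → ℤˣ) → ℝ) (c : ℤˣ) (ε : Fin n → ℤˣ) :
    noise ρ Φ (Fin.cons c ε)
      = noise ρ (fun δ => (1 + ρ * (c : ℤ)) / 2 * Φ (Fin.cons 1 δ)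
          + (1 - ρ * (c : ℤ)) / 2 * Φ (Fin.cons (-1) δ)) ε := by
  simp only [noise_apply, sum_signs_succ, Fin.prod_univ_succ, Fin.cons_zero, Fin.cons_succ]
  refine Finset.sum_congr rfl fun δ _ => ?_
  push_cast
  ring

theorem noise_mono {ρ : ℝ} (hρ : |ρ| ≤ 1) {Φ Ψ : (Fin n → ℤˣ) → ℝ} (h : Φ ≤ Ψ) :
    noise ρ Φ ≤ noise ρ Ψ := by
  intro ε
  simp only [noise_apply]
  refine Finset.sum_le_sum fun δ _ => mul_le_mul_of_nonneg_left (h δ) ?_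
  refine Finset.prod_nonneg fun j _ => div_nonneg ?_ two_pos.le
  rcases Int.units_eq_one_or (ε j * δ j) with hj | hj <;> rw [hj] <;> push_cast <;>
    linarith [abs_le.1 hρ]

theorem le_noise_of_convexOn {F : Type*} [AddCommGroup F] [Module ℝ F] {φ : F → ℝ}
    (hφ : ConvexOn ℝ Set.univ φ) {ρ : ℝ} (hρ : |ρ| ≤ 1) (h : F) (x : Fin n → F)
    (ε : Fin n → ℤˣ) :
    φ (h + ρ • ∑ i, ε i • x i) ≤ noise ρ (fun δ => φ (h + ∑ i, δ i • x i)) ε := by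
  induction n generalizing h with
  | zero => simp [noise_fin_zero]
  | succ n ih =>
    obtain ⟨c, ε, rfl⟩ : ∃ c ε', Fin.cons c ε' = ε := ⟨ε 0, Fin.tail ε, Fin.cons_self_tail ε⟩
    have hc : |ρ * (c : ℤ)| ≤ 1 := by
      rcases Int.units_eq_one_or c with rfl | rfl <;> simpa using hρ
    have hcombo (y : F) : φ (h + (ρ * (c : ℤ)) • x 0 + y)
        ≤ (1 + ρ * (c : ℤ)) / 2 * φ (h + (x 0 + y))
          + (1 - ρ * (c : ℤ)) / 2 * φ (h + (-x 0 + y)) := by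
      have hpoint : h + (ρ * (c : ℤ)) • x 0 + y = ((1 + ρ * (c : ℤ)) / 2) • (h + (x 0 + y))
          + ((1 - ρ * (c : ℤ)) / 2) • (h + (-x 0 + y)) := by module
      rw [hpoint]
      exact hφ.2 trivial trivial (by linarith [abs_le.1 hc]) (by linarith [abs_le.1 hc]) (by ring)
    have hsum : h + ρ • ∑ i, (Fin.cons c ε : Fin (n + 1) → ℤˣ) i • x i
        = h + (ρ * (c : ℤ)) • x 0 + ρ • ∑ i, ε i • x i.succ := by
      simp only [Fin.sum_univ_succ, Fin.cons_zero, Fin.cons_succ, smul_add, mul_smul,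
        Int.cast_smul_eq_zsmul, Units.smul_def, add_assoc]
    rw [hsum, noise_cons]
    refine (ih _ (fun i => x i.succ) ε).trans (noise_mono hρ (fun δ => ?_) ε)
    simpa only [Fin.sum_univ_succ, Fin.cons_zero, Fin.cons_succ, one_smul, Units.neg_smul]
      using hcombo (∑ i, δ i • x i.succ)

theorem two_point_hypercontractivity {ρ : ℝ} (hρ : 3 * ρ ^ 2 ≤ 1) (a b : ℝ) :
    ((a + ρ * b) ^ 4 + (a - ρ * b) ^ 4) / 2 ≤ a ^ 4 + 2 * (a ^ 2 * b ^ 2) + b ^ 4 := by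
  have hρ4 : ρ ^ 4 ≤ 1 := by nlinarith [sq_nonneg ρ]
  nlinarith [mul_le_mul_of_nonneg_right hρ (mul_nonneg (sq_nonneg a) (sq_nonneg b)),
    mul_le_mul_of_nonneg_right hρ4 (sq_nonneg (b ^ 2))]

theorem expect_noise_pow_four_le {ρ : ℝ} (hρ : 3 * ρ ^ 2 ≤ 1) (Φ : (Fin n → ℤˣ) → ℝ) :
    𝔼 ε, noise ρ Φ ε ^ 4 ≤ (𝔼 ε, Φ ε ^ 2) ^ 2 := by
  induction n with
  | zero => simp [noise_fin_zero, ← pow_mul]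
  | succ n ih =>
    set Φ₀ : (Fin n → ℤˣ) → ℝ := fun δ => (Φ (Fin.cons 1 δ) + Φ (Fin.cons (-1) δ)) / 2
    set Φ₁ : (Fin n → ℤˣ) → ℝ := fun δ => (Φ (Fin.cons 1 δ) - Φ (Fin.cons (-1) δ)) / 2
    set A : ℝ := 𝔼 ε, Φ₀ ε ^ 2
    set B : ℝ := 𝔼 ε, Φ₁ ε ^ 2
    have hA : 0 ≤ A := Finset.expect_nonneg fun _ _ => sq_nonneg _
    have hB : 0 ≤ B := Finset.expect_nonneg fun _ _ => sq_nonneg _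
    have hcross : 𝔼 ε, noise ρ Φ₀ ε ^ 2 * noise ρ Φ₁ ε ^ 2 ≤ A * B := by
      refine le_of_sq_le_sq ?_ (mul_nonneg hA hB)
      calc (𝔼 ε, noise ρ Φ₀ ε ^ 2 * noise ρ Φ₁ ε ^ 2) ^ 2
          ≤ (𝔼 ε, (noise ρ Φ₀ ε ^ 2) ^ 2) * 𝔼 ε, (noise ρ Φ₁ ε ^ 2) ^ 2 :=
            Finset.expect_mul_sq_le_sq_mul_sq _ _ _
        _ ≤ A ^ 2 * B ^ 2 := by
            simp only [← pow_mul]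
            exact mul_le_mul (ih Φ₀) (ih Φ₁)
              (Finset.expect_nonneg fun _ _ => Even.pow_nonneg (by decide) _) (sq_nonneg A)
        _ = (A * B) ^ 2 := (mul_pow A B 2).symm
    have hsplit (c : ℤˣ) (ε : Fin n → ℤˣ) :
        noise ρ Φ (Fin.cons c ε) = noise ρ Φ₀ ε + ρ * (c : ℤ) * noise ρ Φ₁ ε := by
      rw [noise_cons, ← smul_eq_mul _ (noise ρ Φ₁ ε), ← Pi.smul_apply, ← map_smul, ← Pi.add_apply,
        ← map_add]
      refine congrArg (noise ρ · ε) (funext fun δ => ?_)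
      simp only [Φ₀, Φ₁, Pi.add_apply, Pi.smul_apply, smul_eq_mul]
      ring
    calc 𝔼 ε, noise ρ Φ ε ^ 4
        ≤ 𝔼 ε, (noise ρ Φ₀ ε ^ 4 + 2 * (noise ρ Φ₀ ε ^ 2 * noise ρ Φ₁ ε ^ 2)
            + noise ρ Φ₁ ε ^ 4) := by
          rw [expect_signs_succ]
          refine Finset.expect_le_expect fun ε _ => ?_
          simpa [hsplit, ← sub_eq_add_neg]
            using two_point_hypercontractivity hρ (noise ρ Φ₀ ε) (noise ρ Φ₁ ε)
      _ ≤ A ^ 2 + 2 * (A * B) + B ^ 2 := by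
          simp only [Finset.expect_add_distrib, ← Finset.mul_expect]
          linarith [ih Φ₀, ih Φ₁]
      _ = (𝔼 ε, Φ ε ^ 2) ^ 2 := by
          rw [expect_signs_succ, ← mul_assoc, ← add_sq, ← Finset.expect_add_distrib]
          congr 2 with ε
          ring

end Noise

section Kahane

theorem rpow_expect_le_expect_rpow {ι : Type*} [Fintype ι] [Nonempty ι] {a : ι → ℝ}
    (ha : ∀ i, 0 ≤ a i) {s : ℝ} (hs : 1 ≤ s) : (𝔼 i, a i) ^ s ≤ 𝔼 i, a i ^ s := by
  have hweights : ∑ _i : ι, (Fintype.card ι : ℝ)⁻¹ = 1 := by simp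
  simpa only [Fintype.expect_eq_sum_div_card, div_eq_inv_mul, ← Finset.mul_sum] using
    Real.rpow_arith_mean_le_arith_mean_rpow Finset.univ _ a (fun _ _ => by positivity) hweights
      (fun i _ => ha i) hs

theorem expect_rpow_rpow_inv_mono {ι : Type*} [Fintype ι] [Nonempty ι] {a : ι → ℝ}
    (ha : ∀ i, 0 ≤ a i) {s t : ℝ} (hs : 0 < s) (hst : s ≤ t) :
    (𝔼 i, a i ^ s) ^ (1 / s) ≤ (𝔼 i, a i ^ t) ^ (1 / t) := by
  have ht : 0 < t := hs.trans_le hst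
  have has (i : ι) : 0 ≤ a i ^ s := Real.rpow_nonneg (ha i) s
  have hmean : 0 ≤ 𝔼 i, a i ^ s := Finset.expect_nonneg fun i _ => has i
  calc (𝔼 i, a i ^ s) ^ (1 / s)
      = ((𝔼 i, a i ^ s) ^ (t / s)) ^ (1 / t) := by
        rw [← Real.rpow_mul hmean]
        field_simp
    _ ≤ (𝔼 i, (a i ^ s) ^ (t / s)) ^ (1 / t) := by
        refine Real.rpow_le_rpow (by positivity) ?_ (by positivity)
        exact rpow_expect_le_expect_rpow has ((one_le_div hs).2 hst)
    _ = (𝔼 i, a i ^ t) ^ (1 / t) := by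
        simp only [← Real.rpow_mul (ha _), mul_div_cancel₀ t hs.ne']

theorem expect_sq_le_of_expect_pow_four_le {ι : Type*} [Fintype ι] {a : ι → ℝ}
    (ha : ∀ i, 0 ≤ a i) {C : ℝ} (hC : 0 < C) (h : 𝔼 i, a i ^ 4 ≤ C * (𝔼 i, a i ^ 2) ^ 2) :
    𝔼 i, a i ^ 2 ≤ C * (𝔼 i, a i) ^ 2 := by
  have hsq : 0 ≤ 𝔼 i, a i ^ 2 := Finset.expect_nonneg fun _ _ => sq_nonneg _
  obtain hzero | hpos := hsq.eq_or_lt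
  · rw [← hzero]
    positivity
  set r : ℝ := √(C * 𝔼 i, a i ^ 2)
  have hr : 0 < r := Real.sqrt_pos.2 (mul_pos hC hpos)
  have hr2 : r ^ 2 = C * 𝔼 i, a i ^ 2 := Real.sq_sqrt (mul_pos hC hpos).le
  have hamgm : 3 * 𝔼 i, a i ^ 2 ≤ 2 * r * 𝔼 i, a i + (𝔼 i, a i ^ 4) / r ^ 2 := by
    simp only [Finset.mul_expect, Finset.expect_div, ← Finset.expect_add_distrib]
    refine Finset.expect_le_expect fun i _ => ?_
    have hdiff : 2 * r * a i + a i ^ 4 / r ^ 2 - 3 * a i ^ 2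
        = a i * (a i - r) ^ 2 * (a i + 2 * r) / r ^ 2 := by
      field_simp
      ring
    have := ha i
    have : 0 ≤ a i * (a i - r) ^ 2 * (a i + 2 * r) / r ^ 2 := by positivity
    linarith
  have hfourth : (𝔼 i, a i ^ 4) / r ^ 2 ≤ 𝔼 i, a i ^ 2 := by
    rw [div_le_iff₀ (by positivity), hr2]
    linarith
  have hlin : 𝔼 i, a i ^ 2 ≤ r * 𝔼 i, a i := by linarith
  have hsquare := pow_le_pow_left₀ hsq hlin 2
  rw [mul_pow, hr2] at hsquare
  exact le_of_mul_le_mul_right (by linarith) hpos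

variable {F : Type*} [NormedAddCommGroup F] [NormedSpace ℝ F]

theorem expect_norm_sum_pow_four_mul_le (x : Fin n → F) (j : ℕ) :
    𝔼 ε : Fin n → ℤˣ, ‖∑ i, ε i • x i‖ ^ (4 * j)
      ≤ 16 ^ j * (𝔼 ε : Fin n → ℤˣ, ‖∑ i, ε i • x i‖ ^ (2 * j)) ^ 2 := by
  set Φ : (Fin n → ℤˣ) → ℝ := fun ε => ‖∑ i, ε i • x i‖ ^ j
  have hnoise (ε : Fin n → ℤˣ) : ‖∑ i, ε i • x i‖ ^ (4 * j) ≤ 16 ^ j * noise (1 / 2) Φ ε ^ 4 := by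
    have hconvex := (convexOn_univ_norm (E := F)).pow (fun _ _ => norm_nonneg _) j
    have hle := le_noise_of_convexOn hconvex (ρ := 1 / 2) (by norm_num [abs_le]) 0 x ε
    simp only [zero_add, Pi.pow_apply, norm_smul, mul_pow] at hle
    calc ‖∑ i, ε i • x i‖ ^ (4 * j)
        = 16 ^ j * (‖(1 / 2 : ℝ)‖ ^ j * ‖∑ i, ε i • x i‖ ^ j) ^ 4 := by
          rw [mul_pow, ← pow_mul, ← pow_mul, mul_comm j 4, pow_mul ‖(1 / 2 : ℝ)‖, ← mul_assoc,
            ← mul_pow]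
          norm_num
      _ ≤ 16 ^ j * noise (1 / 2) Φ ε ^ 4 := by gcongr
  calc 𝔼 ε : Fin n → ℤˣ, ‖∑ i, ε i • x i‖ ^ (4 * j)
      ≤ 16 ^ j * 𝔼 ε, noise (1 / 2) Φ ε ^ 4 := by
        rw [Finset.mul_expect]
        exact Finset.expect_le_expect fun ε _ => hnoise ε
    _ ≤ 16 ^ j * (𝔼 ε, Φ ε ^ 2) ^ 2 := by
        gcongr
        exact expect_noise_pow_four_le (by norm_num) Φ
    _ = 16 ^ j * (𝔼 ε : Fin n → ℤˣ, ‖∑ i, ε i • x i‖ ^ (2 * j)) ^ 2 := by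
        simp only [Φ, ← pow_mul, mul_comm j 2]

theorem expect_norm_sum_pow_two_pow_le (x : Fin n → F) (m : ℕ) :
    𝔼 ε : Fin n → ℤˣ, ‖∑ i, ε i • x i‖ ^ 2 ^ (m + 1)
      ≤ (2 ^ (m + 2) * 𝔼 ε : Fin n → ℤˣ, ‖∑ i, ε i • x i‖) ^ 2 ^ (m + 1) := by
  set mean : ℝ := 𝔼 ε : Fin n → ℤˣ, ‖∑ i, ε i • x i‖
  induction m with
  | zero =>
    have hfour := expect_norm_sum_pow_four_mul_le x 1
    simp only [mul_one, pow_one] at hfour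
    have hsq := expect_sq_le_of_expect_pow_four_le
      (fun ε : Fin n → ℤˣ => norm_nonneg (∑ i, ε i • x i)) (by norm_num) hfour
    simp only [zero_add, pow_one]
    linarith
  | succ m ih =>
    calc 𝔼 ε : Fin n → ℤˣ, ‖∑ i, ε i • x i‖ ^ 2 ^ (m + 1 + 1)
        = 𝔼 ε : Fin n → ℤˣ, ‖∑ i, ε i • x i‖ ^ (4 * 2 ^ m) := by ring_nf
      _ ≤ 16 ^ 2 ^ m * (𝔼 ε : Fin n → ℤˣ, ‖∑ i, ε i • x i‖ ^ 2 ^ (m + 1)) ^ 2 := by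
        rw [pow_succ' 2 m]
        exact expect_norm_sum_pow_four_mul_le x (2 ^ m)
      _ ≤ 16 ^ 2 ^ m * ((2 ^ (m + 2) * mean) ^ 2 ^ (m + 1)) ^ 2 := by
        gcongr
      _ = (2 ^ (m + 1 + 2) * mean) ^ 2 ^ (m + 1 + 1) := by
        rw [← pow_mul, ← pow_succ, show (16 : ℝ) = 2 ^ 4 by norm_num, ← pow_mul,
          show 4 * 2 ^ m = 2 ^ (m + 1 + 1) by ring, ← mul_pow]
        ring

theorem kahane_inequality (x : Fin n → F) {p q : ℝ} (hp : 1 ≤ p) (hq : 0 < q) :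
    (𝔼 ε : Fin n → ℤˣ, ‖∑ i, ε i • x i‖ ^ q) ^ (1 / q)
      ≤ 2 ^ (⌈q⌉₊ + 2) * (𝔼 ε : Fin n → ℤˣ, ‖∑ i, ε i • x i‖ ^ p) ^ (1 / p) := by
  set S : (Fin n → ℤˣ) → ℝ := fun ε => ‖∑ i, ε i • x i‖
  have hS (ε : Fin n → ℤˣ) : 0 ≤ S ε := norm_nonneg _
  have : 0 ≤ 𝔼 ε, S ε := Finset.expect_nonneg fun ε _ => hS ε
  set N : ℕ := 2 ^ (⌈q⌉₊ + 1)
  have hqN : q ≤ N := (Nat.le_ceil q).trans <| by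
    exact_mod_cast (Nat.le_succ _).trans Nat.lt_two_pow_self.le
  calc (𝔼 ε, S ε ^ q) ^ (1 / q)
      ≤ (𝔼 ε, S ε ^ (N : ℝ)) ^ (1 / (N : ℝ)) := expect_rpow_rpow_inv_mono hS hq hqN
    _ ≤ ((2 ^ (⌈q⌉₊ + 2) * 𝔼 ε, S ε) ^ N) ^ (1 / (N : ℝ)) := by
        simp only [Real.rpow_natCast]
        refine Real.rpow_le_rpow (Finset.expect_nonneg fun ε _ => pow_nonneg (hS ε) N) ?_
          (by positivity)
        exact expect_norm_sum_pow_two_pow_le x ⌈q⌉₊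
    _ = 2 ^ (⌈q⌉₊ + 2) * (𝔼 ε, S ε ^ (1 : ℝ)) ^ (1 / 1 : ℝ) := by
        rw [one_div, Real.pow_rpow_inv_natCast (by positivity) (by positivity)]
        simp only [Real.rpow_one, div_one]
    _ ≤ 2 ^ (⌈q⌉₊ + 2) * (𝔼 ε, S ε ^ p) ^ (1 / p) := by
        gcongr
        exact expect_rpow_rpow_inv_mono hS one_pos hp

end Kahane

section Rademacher

namespace IsRademacherFamily

variable {Ω : Type*} [MeasurableSpace Ω] {P : Measure Ω} {r : ℕ → Ω → ℝ}

theorem measure_eq_intUnit (hr : IsRademacherFamily P r) (j : ℕ) (c : ℤˣ) :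
    P (r j ⁻¹' {((c : ℤ) : ℝ)}) = 1 / 2 := by
  rcases Int.units_eq_one_or c with rfl | rfl
  · simpa [Set.preimage] using hr.measure_one j
  · simpa [Set.preimage] using hr.measure_neg_one j

theorem measure_forall_eq (hr : IsRademacherFamily P r) (ε : Fin n → ℤˣ) :
    P {ω | ∀ j : Fin n, r j ω = (ε j : ℤ)} = (2 ^ n)⁻¹ := by
  have hindep := (hr.indep.precomp (g := fun j : Fin n => (j : ℕ))
    Fin.val_injective).measure_inter_preimage_eq_mul Finset.univ
    (sets := fun j => {((ε j : ℤ) : ℝ)}) fun j _ => measurableSet_singleton _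
  simp only [Finset.mem_univ, Set.iInter_true, hr.measure_eq_intUnit, Finset.prod_const,
    Finset.card_univ, Fintype.card_fin] at hindep
  rw [ENNReal.inv_pow, ← one_div, ← hindep]
  congr 1
  ext ω
  simp

theorem existsUnique_sign (hr : IsRademacherFamily P r) (ω : Ω) :
    ∃! ε : Fin n → ℤˣ, ∀ j : Fin n, r j ω = (ε j : ℤ) := by
  have hsign (j : Fin n) : ∃ c : ℤˣ, r j ω = (c : ℤ) := by
    rcases hr.eq_or_eq j ω with h | h
    · exact ⟨-1, by simp [h]⟩
    · exact ⟨1, by simp [h]⟩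
  choose ε hε using hsign
  refine ⟨ε, hε, fun δ hδ => funext fun j => Units.ext ?_⟩
  exact_mod_cast (hδ j).symm.trans (hε j)

theorem integral_eq_expect [IsProbabilityMeasure P] (hr : IsRademacherFamily P r)
    (Φ : (Fin n → ℝ) → ℝ) :
    ∫ ω, Φ (fun j => r j ω) ∂P = 𝔼 ε : Fin n → ℤˣ, Φ fun j => (ε j : ℤ) := by
  classical
  let A (ε : Fin n → ℤˣ) : Set Ω := {ω | ∀ j : Fin n, r j ω = (ε j : ℤ)}
  have hA (ε : Fin n → ℤˣ) : MeasurableSet (A ε) := by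
    refine measurableSet_setOfPred.2 <| Measurable.forall fun j => ?_
    exact measurableSet_setOfPred.1 (hr.measurable j (measurableSet_singleton _))
  have hdecomp (ω : Ω) : Φ (fun j => r j ω)
      = ∑ ε, (A ε).indicator (fun _ => Φ fun j => ((ε j : ℤ) : ℝ)) ω := by
    obtain ⟨ε, hε, huniq⟩ := hr.existsUnique_sign (n := n) ω
    rw [Fintype.sum_eq_single ε fun δ hδ =>
      Set.indicator_of_notMem (s := A δ) (fun hωδ => hδ (huniq δ hωδ)) _,
      Set.indicator_of_mem (s := A ε) hε]
    exact congrArg Φ (funext hε)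
  simp_rw [hdecomp]
  rw [integral_finsetSum _ fun ε _ => (integrable_const _).indicator (hA ε)]
  simp only [integral_indicator_const _ (hA _), measureReal_def, A, hr.measure_forall_eq,
    Fintype.expect_eq_sum_div_card, Finset.sum_div, smul_eq_mul]
  simp [div_eq_inv_mul]

variable {F : Type*} [NormedAddCommGroup F] [NormedSpace ℝ F]

theorem lpNorm_sum_eq [IsProbabilityMeasure P] (hr : IsRademacherFamily P r) (x : Fin n → F)
    {s : ℝ} (hs : 0 < s) :
    lpNorm (fun ω => ∑ j : Fin n, r j ω • x j) (ENNReal.ofReal s) P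
      = (𝔼 ε : Fin n → ℤˣ, ‖∑ j, ε j • x j‖ ^ s) ^ (1 / s) := by
  have hmeas : StronglyMeasurable fun ω => ∑ j : Fin n, r j ω • x j :=
    Finset.stronglyMeasurable_fun_sum _ fun j _ =>
      (hr.measurable j).stronglyMeasurable.smul_const (x j)
  rw [lpNorm_eq_integral_norm_rpow_toReal (by simpa using hs) (by simp)
    hmeas.aestronglyMeasurable, ENNReal.toReal_ofReal hs.le, one_div,
    hr.integral_eq_expect fun e => ‖∑ j, e j • x j‖ ^ s]
  simp only [Int.cast_smul_eq_zsmul, Units.smul_def]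

theorem completion (hr : IsRademacherFamily P r) :
    IsRademacherFamily (Ω := NullMeasurableSpace Ω P) P.completion r where
  measurable j _ hs := (hr.measurable j hs).nullMeasurableSet
  eq_or_eq := hr.eq_or_eq
  measure_neg_one := hr.measure_neg_one
  measure_one := hr.measure_one
  indep := iIndepFun_iff_measure_inter_preimage_eq_mul.2 fun S _ hs =>
    hr.indep.measure_inter_preimage_eq_mul S hs

end IsRademacherFamily

theorem isRademacherFamily_infinitePi :
    IsRademacherFamily (Measure.infinitePi fun _ : ℕ => (PMF.uniformOfFintype Bool).toMeasure)
      fun j ω => if ω j then 1 else -1 := by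
  let ν : Measure Bool := (PMF.uniformOfFintype Bool).toMeasure
  have hcoord (j : ℕ) (b : Bool) : Measure.infinitePi (fun _ => ν) {ω | ω j = b} = 1 / 2 := by
    refine ((measurePreserving_eval_infinitePi (fun _ : ℕ => ν) j).measure_preimage
      (measurableSet_singleton b).nullMeasurableSet).trans ?_
    simp [ν]
  refine ⟨fun j => ?_, fun j ω => ?_, fun j => ?_, fun j => ?_, ?_⟩
  · exact (measurable_of_finite fun b : Bool => if b then (1 : ℝ) else -1).comp
      (measurable_pi_apply j)
  · cases ω j <;> simp
  · refine (congrArg _ (Set.ext fun ω => ?_)).trans (hcoord j false)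
    cases hω : ω j <;> norm_num [hω]
  · refine (congrArg _ (Set.ext fun ω => ?_)).trans (hcoord j true)
    cases hω : ω j <;> norm_num [hω]
  · exact iIndepFun_infinitePi (P := fun _ : ℕ => ν) (X := fun _ b => if b then (1 : ℝ) else -1)
      fun _ => measurable_of_finite _

theorem exists_isRademacherFamily :
    ∃ (Ω : Type) (_ : MeasurableSpace Ω) (P : Measure Ω) (_ : IsProbabilityMeasure P)
      (_ : P.IsComplete) (r : ℕ → Ω → ℝ), IsRademacherFamily P r :=
  let Q : Measure (ℕ → Bool) := Measure.infinitePi fun _ => (PMF.uniformOfFintype Bool).toMeasure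
  ⟨NullMeasurableSpace (ℕ → Bool) Q, inferInstance, Q.completion, ⟨measure_univ (μ := Q)⟩,
    inferInstance, _, isRademacherFamily_infinitePi.completion⟩

theorem typeConstant_nonneg (F : Type*) [NormedAddCommGroup F] [NormedSpace ℝ F] (p : ℝ) :
    0 ≤ typeConstant F p :=
  Real.sInf_nonneg fun _ h => h.1.le

theorem khintchineConstant_nonneg (q : ℝ) : 0 ≤ khintchineConstant q :=
  Real.sInf_nonneg fun _ h => h.1.le

theorem kahaneKhintchineConstant_nonneg (q p : ℝ) : 0 ≤ kahaneKhintchineConstant.{u} q p :=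
  Real.sInf_nonneg fun _ h => h.1.le

theorem le_sInf_mul {s : Set ℝ} (hs : s.Nonempty) {a b : ℝ} (hb : 0 ≤ b)
    (h : ∀ c ∈ s, a ≤ c * b) : a ≤ sInf s * b := by
  rcases hb.eq_or_lt with rfl | hb
  · obtain ⟨c, hc⟩ := hs
    simpa using h c hc
  · rw [← div_le_iff₀ hb]
    exact le_csInf hs fun c hc => (div_le_iff₀ hb).2 (h c hc)

theorem expect_norm_sum_rpow_le_typeConstant {F : Type*} [NormedAddCommGroup F]
    [NormedSpace ℝ F] {p : ℝ} (hp : 0 < p) (hF : HasRademacherType F p) (x : Fin n → F) :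
    (𝔼 ε : Fin n → ℤˣ, ‖∑ j, ε j • x j‖ ^ p) ^ (1 / p)
      ≤ typeConstant F p * (∑ j, ‖x j‖ ^ p) ^ (1 / p) := by
  obtain ⟨Ω, _, P, _, _, r, hr⟩ := exists_isRademacherFamily
  rw [← hr.lpNorm_sum_eq x hp]
  exact le_sInf_mul hF (by positivity) fun τ hτ => hτ.2 Ω P r hr n x

theorem expect_norm_sum_rpow_le_kahaneKhintchineConstant {F : Type u} [NormedAddCommGroup F]
    [NormedSpace ℝ F] {p q : ℝ} (hp : 1 ≤ p) (hq : 0 < q) (x : Fin n → F) :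
    (𝔼 ε : Fin n → ℤˣ, ‖∑ j, ε j • x j‖ ^ q) ^ (1 / q)
      ≤ kahaneKhintchineConstant.{u} q p
        * (𝔼 ε : Fin n → ℤˣ, ‖∑ j, ε j • x j‖ ^ p) ^ (1 / p) := by
  have hp0 : 0 < p := zero_lt_one.trans_le hp
  obtain ⟨Ω, _, P, _, _, r, hr⟩ := exists_isRademacherFamily
  -- `F` need not be complete, but the finite-dimensional span of the vectors is.
  let y (j : Fin n) : Submodule.span ℝ (Set.range x) := ⟨x j, Submodule.subset_span ⟨j, rfl⟩⟩
  have : FiniteDimensional ℝ (Submodule.span ℝ (Set.range x)) :=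
    FiniteDimensional.span_of_finite ℝ (Set.finite_range x)
  have : CompleteSpace (Submodule.span ℝ (Set.range x)) := FiniteDimensional.complete ℝ _
  have hy : ∀ ε : Fin n → ℤˣ, ‖∑ j, ε j • x j‖ = ‖∑ j, ε j • y j‖ := fun ε => by
    simp only [y, Submodule.coe_norm, Submodule.coe_sum, Units.smul_def,
      Submodule.coe_smul_of_tower]
  simp only [hy, ← hr.lpNorm_sum_eq y hq, ← hr.lpNorm_sum_eq y hp0]
  refine le_sInf_mul ?_ lpNorm_nonneg fun K hK => hK.2 Ω P r hr _ n y
  refine ⟨2 ^ (⌈q⌉₊ + 2), by positivity, fun Ω _ P _ _ r hr G _ _ _ m z => ?_⟩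
  rw [hr.lpNorm_sum_eq z hq, hr.lpNorm_sum_eq z hp0]
  exact kahane_inequality z hp hq

theorem expect_norm_sum_rpow_le {F : Type u} [NormedAddCommGroup F] [NormedSpace ℝ F] {p q : ℝ}
    (hp : 1 ≤ p) (hq : 0 < q) (hF : HasRademacherType F p) (x : Fin n → F) :
    𝔼 ε : Fin n → ℤˣ, ‖∑ j, ε j • x j‖ ^ q
      ≤ (kahaneKhintchineConstant.{u} q p * typeConstant F p) ^ q
        * (∑ j, ‖x j‖ ^ p) ^ (q / p) := by
  have hK := kahaneKhintchineConstant_nonneg.{u} q p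
  have hτ := typeConstant_nonneg F p
  have hroot : (𝔼 ε : Fin n → ℤˣ, ‖∑ j, ε j • x j‖ ^ q) ^ (1 / q)
      ≤ kahaneKhintchineConstant.{u} q p * (typeConstant F p * (∑ j, ‖x j‖ ^ p) ^ (1 / p)) :=
    (expect_norm_sum_rpow_le_kahaneKhintchineConstant hp hq x).trans <|
      mul_le_mul_of_nonneg_left
        (expect_norm_sum_rpow_le_typeConstant (zero_lt_one.trans_le hp) hF x) hK
  calc 𝔼 ε : Fin n → ℤˣ, ‖∑ j, ε j • x j‖ ^ q
      = ((𝔼 ε : Fin n → ℤˣ, ‖∑ j, ε j • x j‖ ^ q) ^ (1 / q)) ^ q := by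
        rw [← Real.rpow_mul (by positivity), one_div_mul_cancel hq.ne', Real.rpow_one]
    _ ≤ (kahaneKhintchineConstant.{u} q p
          * (typeConstant F p * (∑ j, ‖x j‖ ^ p) ^ (1 / p))) ^ q := by gcongr
    _ = _ := by
        rw [← mul_assoc, Real.mul_rpow (by positivity) (by positivity),
          ← Real.rpow_mul (by positivity), one_div_mul_eq_div]

end Rademacher

section TensorPower

variable {k : ℕ} {E : Type u} [NormedAddCommGroup E] [NormedSpace ℝ E]

theorem norm_pow_sub_pow_le {R : Type*} [SeminormedCommRing R] [NormOneClass R] (a b : R) (k : ℕ) :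
    ‖a ^ k - b ^ k‖ ≤ ‖a - b‖ * ∑ i ∈ Finset.range k, ‖a‖ ^ i * ‖b‖ ^ (k - i - 1) := by
  rw [← (Commute.all a b).mul_geom_sum₂ k]
  refine (norm_mul_le _ _).trans ?_
  gcongr
  refine norm_sum_le_of_le _ fun i _ => (norm_mul_le _ _).trans ?_
  rw [Nat.sub_right_comm]
  gcongr <;> exact norm_pow_le _ _

theorem abs_dual_apply_le (f : Metric.closedBall (0 : StrongDual ℝ E) 1) (x : E) :
    |f.1 x| ≤ ‖x‖ :=
  f.1.le_of_opNorm_le_of_le (mem_closedBall_zero_iff.1 f.2) le_rfl |>.trans_eq (one_mul _)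

theorem abs_dual_apply_pow_sub_pow_le (k : ℕ) (f g : Metric.closedBall (0 : StrongDual ℝ E) 1)
    (x : E) :
    |f.1 x ^ k - g.1 x ^ k| ≤ k * ‖x‖ ^ (k - 1) * |f.1 x - g.1 x| := by
  calc |f.1 x ^ k - g.1 x ^ k|
      ≤ |f.1 x - g.1 x| * k * max |f.1 x| |g.1 x| ^ (k - 1) := abs_pow_sub_pow_le ..
    _ ≤ |f.1 x - g.1 x| * k * ‖x‖ ^ (k - 1) := by
        gcongr
        exact max_le (abs_dual_apply_le f x) (abs_dual_apply_le g x)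
    _ = k * ‖x‖ ^ (k - 1) * |f.1 x - g.1 x| := by ring

variable (E) in
/-- Evaluation of functionals, embedding `E` into the bounded continuous functions on the dual
unit ball; tensor powers in `E` become pointwise powers of functions. -/
def dualEval : E →ₗ[ℝ] (Metric.closedBall (0 : StrongDual ℝ E) 1 →ᵇ ℝ) where
  toFun x := .ofNormedAddCommGroup (fun f => f.1 x) (by fun_prop) ‖x‖ fun f => abs_dual_apply_le f x
  map_add' x y := by ext f; exact map_add f.1 x y
  map_smul' c x := by ext f; exact map_smul f.1 c x

theorem dualEval_apply (x : E) (f : Metric.closedBall (0 : StrongDual ℝ E) 1) :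
    dualEval E x f = f.1 x := rfl

theorem norm_dualEval_le (x : E) : ‖dualEval E x‖ ≤ ‖x‖ :=
  norm_ofNormedAddCommGroup_le _ (norm_nonneg x) fun f => abs_dual_apply_le f x

theorem continuous_tensorEval_diagonal (U : AlgTensor k E) :
    Continuous fun f : StrongDual ℝ E => tensorEval (fun _ => f) U := by
  induction U using algTensor_induction with
  | smul c x =>
    simp only [map_smul, tensorEval_elemTensor]
    fun_prop
  | add U V hU hV =>
    simp only [map_add]
    exact hU.add hV

variable (k E) in
/-- The isometric embedding of the symmetric tensor product into the bounded continuous functions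
on the dual unit ball, sending `U` to `f ↦ (f ⊗ ⋯ ⊗ f) U`. -/
def symEval : SymAlgTensor k E →ₗᵢ[ℝ] (Metric.closedBall (0 : StrongDual ℝ E) 1 →ᵇ ℝ) where
  toFun U := .ofNormedAddCommGroup (fun f => tensorEval (fun _ => f.1) (symInclusion k E U))
    ((continuous_tensorEval_diagonal _).comp continuous_subtype_val) ‖U‖
    (abs_tensorEval_le_symNorm U)
  map_add' U V := by ext f; simp
  map_smul' c U := by ext f; simp
  norm_map' U := norm_eq_iSup_norm _

theorem symEval_symElemPow (x : E) : symEval k E (symElemPow k x) = dualEval E x ^ k := by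
  ext f
  refine (tensorEval_elemTensor (fun _ => f.1) fun _ => x).trans ?_
  simp [dualEval_apply]

theorem norm_symTensorPow_sub_le (x y : E) :
    ‖symTensorPow k x - symTensorPow k y‖
      ≤ ‖x - y‖ * ∑ i ∈ Finset.range k, ‖x‖ ^ i * ‖y‖ ^ (k - i - 1) := by
  have hnorm : ‖symTensorPow k x - symTensorPow k y‖ = ‖dualEval E x ^ k - dualEval E y ^ k‖ := by
    rw [symTensorPow, symTensorPow, ← UniformSpace.Completion.coe_sub,
      UniformSpace.Completion.norm_coe, ← (symEval k E).norm_map, map_sub, symEval_symElemPow,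
      symEval_symElemPow]
  rw [hnorm]
  refine (norm_pow_sub_pow_le _ _ k).trans ?_
  rw [← map_sub]
  gcongr <;> exact norm_dualEval_le _

theorem norm_symTensorPow_le (x : E) : ‖symTensorPow k x‖ ≤ ‖x‖ ^ k := by
  rw [symTensorPow, UniformSpace.Completion.norm_coe, ← (symEval k E).norm_map, symEval_symElemPow]
  exact (norm_pow_le _ k).trans (pow_le_pow_left₀ (norm_nonneg _) (norm_dualEval_le x) k)

theorem norm_sum_sign_smul_symTensorPow (ε : Fin n → ℤˣ) (x : Fin n → E) :
    ‖∑ j, ε j • symTensorPow k (x j)‖ = ‖∑ j, ε j • dualEval E (x j) ^ k‖ := by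
  let ι := UniformSpace.Completion.toComplₗᵢ (𝕜 := ℝ) (E := SymAlgTensor k E)
  have hsum : ∑ j, ε j • symTensorPow k (x j) = ι (∑ j, ε j • symElemPow k (x j)) := by
    simp only [Units.smul_def, map_sum, map_zsmul]
    rfl
  rw [hsum, ι.norm_map, ← (symEval k E).norm_map]
  simp only [Units.smul_def, map_sum, map_zsmul, symEval_symElemPow]

theorem norm_elemTensor_le (x : Fin k → E) : ‖elemTensor k E x‖ ≤ ∏ i, ‖x i‖ := by
  refine ciSup_le fun f => ?_
  rw [tensorEval_elemTensor, Finset.abs_prod]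
  exact Finset.prod_le_prod (fun _ _ => abs_nonneg _) fun i _ => abs_dual_apply_le (f i) (x i)

theorem norm_tensorPow_le (x : E) : ‖tensorPow k x‖ ≤ ‖x‖ ^ k := by
  rw [tensorPow, UniformSpace.Completion.norm_coe]
  simpa using norm_elemTensor_le fun _ : Fin k => x

variable (k E) in
theorem continuous_tensorPow : Continuous (tensorPow k : E → InjTensor k E) := by
  have helem : Continuous (elemTensor k E) :=
    ((elemTensor k E).mkContinuous 1 fun x => by simpa using norm_elemTensor_le x).cont
  exact (UniformSpace.Completion.continuous_coe _).comp
    (helem.comp (continuous_pi fun _ => continuous_id))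

variable (k E) in
theorem continuous_symTensorPow : Continuous (symTensorPow k : E → SymInjTensor k E) := by
  simpa only [Function.comp_def, symProj_tensorPow] using
    (symProj k E).continuous.comp (continuous_tensorPow k E)

theorem expect_norm_sum_symTensorPow_rpow_le_expect {q : ℝ} (hq : 1 ≤ q) (hk : k ≠ 0)
    (x : Fin n → E) :
    𝔼 ε : Fin n → ℤˣ, ‖∑ j, ε j • symTensorPow k (x j)‖ ^ q
      ≤ (2 * k) ^ q * 𝔼 ε : Fin n → ℤˣ, ‖∑ j, ε j • ‖x j‖ ^ (k - 1) • x j‖ ^ q := by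
  let y (j : Fin n) : E := (k * ‖x j‖ ^ (k - 1)) • x j
  have habs (j : Fin n) (t : ℝ) :
      |k * ‖x j‖ ^ (k - 1) * t| = k * ‖x j‖ ^ (k - 1) * |t| := by
    rw [abs_mul, abs_of_nonneg (by positivity)]
  calc 𝔼 ε : Fin n → ℤˣ, ‖∑ j, ε j • symTensorPow k (x j)‖ ^ q
      = 𝔼 ε : Fin n → ℤˣ, ‖∑ j, ε j • dualEval E (x j) ^ k‖ ^ q := by
        simp only [norm_sum_sign_smul_symTensorPow]
    _ ≤ 2 * 𝔼 ε : Fin n → ℤˣ, ‖∑ j, ε j • dualEval E (y j)‖ ^ q := by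
        refine expect_norm_rpow_contraction hq (fun j f => ?_) fun j f g => ?_
        · simpa [y, dualEval_apply, habs, hk] using
            abs_dual_apply_pow_sub_pow_le k f ⟨0, by simp⟩ (x j)
        · simpa [y, dualEval_apply, habs, ← mul_sub] using
            abs_dual_apply_pow_sub_pow_le k f g (x j)
    _ ≤ 2 ^ q * 𝔼 ε : Fin n → ℤˣ, ‖∑ j, ε j • y j‖ ^ q := by
        refine mul_le_mul (Real.self_le_rpow_of_one_le one_le_two hq)
          (Finset.expect_le_expect fun ε _ => ?_) (by positivity) (by positivity)
        have hlin : ∑ j, ε j • dualEval E (y j) = dualEval E (∑ j, ε j • y j) := by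
          simp only [Units.smul_def, map_sum, map_zsmul]
        rw [hlin]
        gcongr
        exact norm_dualEval_le _
    _ = (2 * k) ^ q * 𝔼 ε : Fin n → ℤˣ, ‖∑ j, ε j • ‖x j‖ ^ (k - 1) • x j‖ ^ q := by
        have hsmul (ε : Fin n → ℤˣ) :
            ∑ j, ε j • y j = (k : ℝ) • ∑ j, ε j • ‖x j‖ ^ (k - 1) • x j := by
          simp only [y, Finset.smul_sum, mul_smul, smul_comm (ε _) (k : ℝ)]
        simp only [hsmul, norm_smul, RCLike.norm_natCast, Real.mul_rpow (Nat.cast_nonneg k)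
          (norm_nonneg _), ← Finset.mul_expect, Real.mul_rpow zero_le_two (Nat.cast_nonneg k),
          mul_assoc]

theorem expect_norm_sum_symTensorPow_rpow_le {p q : ℝ} (hp : 1 ≤ p) (hpq : p ≤ q)
    (hE : HasRademacherType E p) (hk : k ≠ 0) (x : Fin n → E) :
    𝔼 ε : Fin n → ℤˣ, ‖∑ j, ε j • symTensorPow k (x j)‖ ^ q
      ≤ (2 * k * kahaneKhintchineConstant.{u} q p * typeConstant E p) ^ q
        * (n ^ (q / p - 1) * ∑ j, (‖x j‖ ^ k) ^ q) := by
  have hp0 : 0 < p := zero_lt_one.trans_le hp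
  have hK := kahaneKhintchineConstant_nonneg.{u} q p
  have hτ := typeConstant_nonneg E p
  have hnorm (j : Fin n) : ‖‖x j‖ ^ (k - 1) • x j‖ = ‖x j‖ ^ k := by
    rw [norm_smul, norm_pow, norm_norm, pow_sub_one_mul hk]
  calc 𝔼 ε : Fin n → ℤˣ, ‖∑ j, ε j • symTensorPow k (x j)‖ ^ q
      ≤ (2 * k) ^ q * 𝔼 ε : Fin n → ℤˣ, ‖∑ j, ε j • ‖x j‖ ^ (k - 1) • x j‖ ^ q :=
        expect_norm_sum_symTensorPow_rpow_le_expect (hp.trans hpq) hk x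
    _ ≤ (2 * k) ^ q * ((kahaneKhintchineConstant.{u} q p * typeConstant E p) ^ q
          * (∑ j, (‖x j‖ ^ k) ^ p) ^ (q / p)) := by
        refine mul_le_mul_of_nonneg_left ?_ (by positivity)
        simpa only [hnorm] using
          expect_norm_sum_rpow_le hp (hp0.trans_le hpq) hE fun j => ‖x j‖ ^ (k - 1) • x j
    _ = (2 * k * kahaneKhintchineConstant.{u} q p * typeConstant E p) ^ q
          * (∑ j, (‖x j‖ ^ k) ^ p) ^ (q / p) := by
        rw [← mul_assoc, ← Real.mul_rpow (by positivity) (by positivity), ← mul_assoc]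
    _ ≤ _ := by
        gcongr
        have hjensen := Real.rpow_sum_le_const_mul_sum_rpow_of_nonneg Finset.univ
          ((one_le_div hp0).2 hpq) fun j _ => (by positivity : 0 ≤ (‖x j‖ ^ k) ^ p)
        simpa only [Finset.card_univ, Fintype.card_fin, ← Real.rpow_mul (pow_nonneg
          (norm_nonneg _) k), mul_div_cancel₀ q hp0.ne'] using hjensen

end TensorPower

section Moments

variable {Ω : Type*} [MeasurableSpace Ω] {P : Measure Ω}

theorem eLpNorm_natCast_pow {F : Type*} [NormedAddCommGroup F] {k : ℕ} (hk : k ≠ 0) (f : Ω → F)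
    (m : ℕ) : eLpNorm f k P ^ m = (∫⁻ ω, ‖f ω‖ₑ ^ k ∂P) ^ ((m : ℝ) / k) := by
  rw [eLpNorm_eq_lintegral_rpow_enorm_toReal (by exact_mod_cast hk) (ENNReal.natCast_ne_top k),
    ← ENNReal.rpow_natCast, ← ENNReal.rpow_mul, ENNReal.toReal_natCast, one_div_mul_eq_div]
  simp only [ENNReal.rpow_natCast]

theorem lintegral_enorm_mul_pow_mul_pow_le {F : Type*} [NormedAddCommGroup F] {f g h : Ω → F}
    (hf : AEStronglyMeasurable f P) (hg : AEStronglyMeasurable g P)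
    (hh : AEStronglyMeasurable h P) {i j k : ℕ} (hk : i + j + 1 = k) :
    ∫⁻ ω, ‖f ω‖ₑ * (‖g ω‖ₑ ^ i * ‖h ω‖ₑ ^ j) ∂P
      ≤ eLpNorm f k P * (eLpNorm g k P ^ i * eLpNorm h k P ^ j) := by
  have hk0 : k ≠ 0 := by omega
  have hkR : (0 : ℝ) < k := by exact_mod_cast hk0.bot_lt
  have hpow (z : ℝ≥0∞) (m : ℕ) : (z ^ k) ^ ((m : ℝ) / k) = z ^ m := by
    rw [← ENNReal.rpow_natCast z k, ← ENNReal.rpow_mul, mul_div_cancel₀ _ hkR.ne',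
      ENNReal.rpow_natCast]
  have hexp : ((1 : ℕ) : ℝ) / k + (i : ℝ) / k + (j : ℝ) / k = 1 := by
    rw [← add_div, ← add_div, div_eq_one_iff_eq hkR.ne', ← hk]
    push_cast
    ring
  have hholder := ENNReal.lintegral_prod_norm_pow_le (μ := P) (Finset.univ : Finset (Fin 3))
    (f := ![fun ω => ‖f ω‖ₑ ^ k, fun ω => ‖g ω‖ₑ ^ k, fun ω => ‖h ω‖ₑ ^ k])
    (p := ![((1 : ℕ) : ℝ) / k, (i : ℝ) / k, (j : ℝ) / k])
    (fun l _ => by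
      fin_cases l
      exacts [hf.enorm.pow_const k, hg.enorm.pow_const k, hh.enorm.pow_const k])
    (by rw [Fin.sum_univ_three]; exact hexp)
    (fun l _ => by fin_cases l <;> exact div_nonneg (Nat.cast_nonneg _) hkR.le)
  simp only [Fin.prod_univ_three, Matrix.cons_val, hpow, ← eLpNorm_natCast_pow hk0, pow_one,
    mul_assoc] at hholder
  exact hholder

variable {k : ℕ} {E : Type*} [NormedAddCommGroup E] [NormedSpace ℝ E] {ξ η : Ω → E}

theorem integrable_tensorPow (hk : k ≠ 0) (hξ : MemLp ξ k P) :
    Integrable (fun ω => tensorPow k (ξ ω)) P :=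
  (hξ.integrable_norm_pow hk).mono' ((continuous_tensorPow k E).comp_aestronglyMeasurable hξ.1)
    (.of_forall fun ω => norm_tensorPow_le (ξ ω))

theorem integrable_symTensorPow (hk : k ≠ 0) (hξ : MemLp ξ k P) :
    Integrable (fun ω => symTensorPow k (ξ ω)) P := by
  simpa only [symProj_tensorPow] using (symProj k E).integrable_comp (integrable_tensorPow hk hξ)

theorem symMoment_eq_integral (hk : k ≠ 0) (hξ : MemLp ξ k P) :
    symMoment k ξ P = ∫ ω, symTensorPow k (ξ ω) ∂P := by
  rw [symMoment, injMoment, ← (symProj k E).integral_comp_comm (integrable_tensorPow hk hξ)]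
  simp only [symProj_tensorPow]

theorem lintegral_enorm_symTensorPow_sub_le (hη : AEStronglyMeasurable η P)
    (hξ : AEStronglyMeasurable ξ P) :
    ∫⁻ ω, ‖symTensorPow k (η ω) - symTensorPow k (ξ ω)‖ₑ ∂P
      ≤ eLpNorm (η - ξ) k P
        * ∑ i ∈ Finset.range k, eLpNorm η k P ^ i * eLpNorm ξ k P ^ (k - i - 1) := by
  have hpoint (x y : E) : ‖symTensorPow k x - symTensorPow k y‖ₑ
      ≤ ∑ i ∈ Finset.range k, ‖x - y‖ₑ * (‖x‖ₑ ^ i * ‖y‖ₑ ^ (k - i - 1)) := by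
    have hnn : ‖symTensorPow k x - symTensorPow k y‖₊
        ≤ ‖x - y‖₊ * ∑ i ∈ Finset.range k, ‖x‖₊ ^ i * ‖y‖₊ ^ (k - i - 1) :=
      NNReal.coe_le_coe.1 (by push_cast [coe_nnnorm]; exact norm_symTensorPow_sub_le x y)
    rw [← Finset.mul_sum]
    simp only [enorm]
    exact_mod_cast hnn
  calc ∫⁻ ω, ‖symTensorPow k (η ω) - symTensorPow k (ξ ω)‖ₑ ∂P
      ≤ ∫⁻ ω, ∑ i ∈ Finset.range k, ‖η ω - ξ ω‖ₑ * (‖η ω‖ₑ ^ i * ‖ξ ω‖ₑ ^ (k - i - 1)) ∂P :=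
        lintegral_mono fun ω => hpoint (η ω) (ξ ω)
    _ = ∑ i ∈ Finset.range k, ∫⁻ ω, ‖η ω - ξ ω‖ₑ * (‖η ω‖ₑ ^ i * ‖ξ ω‖ₑ ^ (k - i - 1)) ∂P :=
        lintegral_finsetSum' _ fun i _ =>
          (hη.sub hξ).enorm.mul ((hη.enorm.pow_const i).mul (hξ.enorm.pow_const _))
    _ ≤ _ := by
        rw [Finset.mul_sum]
        refine Finset.sum_le_sum fun i hi => ?_
        have := Finset.mem_range.1 hi
        exact lintegral_enorm_mul_pow_mul_pow_le (hη.sub hξ) hη hξ (by omega)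

theorem norm_symMoment_sub_le (hk : k ≠ 0) (hη : MemLp η k P) (hξ : MemLp ξ k P) :
    ‖symMoment k η P - symMoment k ξ P‖
      ≤ lpNorm (η - ξ) k P
        * ∑ i ∈ Finset.range k, lpNorm η k P ^ i * lpNorm ξ k P ^ (k - i - 1) := by
  have hfin {f g : Ω → E} (hf : MemLp f k P) (hg : MemLp g k P) (i j : ℕ) :
      eLpNorm f k P ^ i * eLpNorm g k P ^ j ≠ ∞ :=
    ENNReal.mul_ne_top (ENNReal.pow_ne_top hf.eLpNorm_ne_top)
      (ENNReal.pow_ne_top hg.eLpNorm_ne_top)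
  have hle := (enorm_integral_le_lintegral_enorm _).trans
    (lintegral_enorm_symTensorPow_sub_le (k := k) hη.1 hξ.1)
  rw [symMoment_eq_integral hk hη, symMoment_eq_integral hk hξ,
    ← integral_sub (integrable_symTensorPow hk hη) (integrable_symTensorPow hk hξ),
    ← toReal_enorm]
  refine (ENNReal.toReal_mono (ENNReal.mul_ne_top (hη.sub hξ).eLpNorm_ne_top
    (ENNReal.sum_ne_top.2 fun i _ => hfin hη hξ i _)) hle).trans_eq ?_
  simp only [ENNReal.toReal_mul, ENNReal.toReal_sum fun i _ => hfin hη hξ i _, ENNReal.toReal_pow,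
    toReal_eLpNorm (hη.1.sub hξ.1), toReal_eLpNorm hη.1, toReal_eLpNorm hξ.1]

end Moments

section Symmetrization

theorem lpNorm_rpow_eq_integral {X F : Type*} [MeasurableSpace X] [NormedAddCommGroup F]
    {μ : Measure X} {f : X → F} {q : ℝ} (hq : 0 < q) (hf : AEStronglyMeasurable f μ) :
    lpNorm f (ENNReal.ofReal q) μ ^ q = ∫ x, ‖f x‖ ^ q ∂μ := by
  rw [lpNorm_eq_integral_norm_rpow_toReal (ENNReal.ofReal_pos.2 hq).ne' ENNReal.ofReal_ne_top hf,
    ENNReal.toReal_ofReal hq.le, Real.rpow_inv_rpow (by positivity) hq.ne']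

theorem integrable_norm_rpow {X F : Type*} [MeasurableSpace X] [NormedAddCommGroup F]
    {μ : Measure X} {f : X → F} {q : ℝ} (hq : 0 < q) (hf : MemLp f (ENNReal.ofReal q) μ) :
    Integrable (fun x => ‖f x‖ ^ q) μ := by
  simpa only [ENNReal.toReal_ofReal hq.le] using
    hf.integrable_norm_rpow (ENNReal.ofReal_pos.2 hq).ne' ENNReal.ofReal_ne_top

theorem enorm_sub_integral_rpow_le {X F : Type*} [MeasurableSpace X] {μ : Measure X}
    [IsProbabilityMeasure μ] [NormedAddCommGroup F] [NormedSpace ℝ F] [CompleteSpace F]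
    {f : X → F} (hf : Integrable f μ) {q : ℝ} (hq : 1 ≤ q) (c : F) :
    ‖c - ∫ y, f y ∂μ‖ₑ ^ q ≤ ∫⁻ y, ‖c - f y‖ₑ ^ q ∂μ := by
  have hq0 : 0 < q := one_pos.trans_le hq
  have hmean : c - ∫ y, f y ∂μ = ∫ y, (c - f y) ∂μ := by
    rw [integral_sub (integrable_const _) hf, integral_const, probReal_univ, one_smul]
  have hmono := eLpNorm_le_eLpNorm_of_exponent_le (ENNReal.one_le_ofReal.2 hq)
    (aestronglyMeasurable_const.sub hf.1 : AEStronglyMeasurable (fun y => c - f y) μ)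
  rw [eLpNorm_one_eq_lintegral_enorm, eLpNorm_eq_lintegral_rpow_enorm_toReal
    (ENNReal.ofReal_pos.2 hq0).ne' ENNReal.ofReal_ne_top, ENNReal.toReal_ofReal hq0.le] at hmono
  calc ‖c - ∫ y, f y ∂μ‖ₑ ^ q
      ≤ ((∫⁻ y, ‖c - f y‖ₑ ^ q ∂μ) ^ (1 / q)) ^ q := by
        rw [hmean]
        gcongr
        exact (enorm_integral_le_lintegral_enorm _).trans hmono
    _ = ∫⁻ y, ‖c - f y‖ₑ ^ q ∂μ := by
        rw [← ENNReal.rpow_mul, one_div_mul_cancel hq0.ne', ENNReal.rpow_one]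

theorem eLpNorm_sub_integral_le_eLpNorm_prod {X F : Type*} [MeasurableSpace X] {μ : Measure X}
    [IsProbabilityMeasure μ] [NormedAddCommGroup F] [NormedSpace ℝ F] [CompleteSpace F]
    {f : X → F} (hf : Integrable f μ) {q : ℝ} (hq : 1 ≤ q) :
    eLpNorm (fun x => f x - ∫ y, f y ∂μ) (ENNReal.ofReal q) μ
      ≤ eLpNorm (fun z : X × X => f z.1 - f z.2) (ENNReal.ofReal q) (μ.prod μ) := by
  have hq0 : 0 < q := one_pos.trans_le hq
  have hdiff : AEStronglyMeasurable (fun z : X × X => f z.1 - f z.2) (μ.prod μ) :=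
    hf.1.comp_fst.sub hf.1.comp_snd
  simp only [eLpNorm_eq_lintegral_rpow_enorm_toReal (ENNReal.ofReal_pos.2 hq0).ne'
    ENNReal.ofReal_ne_top, ENNReal.toReal_ofReal hq0.le]
  rw [lintegral_prod _ (hdiff.enorm.pow_const q)]
  gcongr with x
  exact enorm_sub_integral_rpow_le hf hq (f x)

variable {ι S F : Type*}

/-- The exchange of the `i`-th coordinates of two families, for those `i` at which the sign `ε i`
is `-1`. On the differences of the coordinates it acts by multiplication with the signs. -/
def signSwap (ε : ι → ℤˣ) (z : (ι → S) × (ι → S)) : (ι → S) × (ι → S) :=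
  (fun i => if ε i = 1 then z.1 i else z.2 i, fun i => if ε i = 1 then z.2 i else z.1 i)

theorem signSwap_fst_sub_snd [AddCommGroup F] (ε : ι → ℤˣ) (z : (ι → F) × (ι → F)) (i : ι) :
    (signSwap ε z).1 i - (signSwap ε z).2 i = ε i • (z.1 i - z.2 i) := by
  rcases Int.units_eq_one_or (ε i) with h | h <;> simp [signSwap, h, Units.smul_def]

variable [Fintype ι]

theorem measurePreserving_signSwap [MeasurableSpace S] (ν : ι → Measure S)
    [∀ i, SigmaFinite (ν i)] (ε : ι → ℤˣ) :
    MeasurePreserving (signSwap ε) ((Measure.pi ν).prod (Measure.pi ν))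
      ((Measure.pi ν).prod (Measure.pi ν)) := by
  let swap (i : ι) : S × S → S × S := if ε i = 1 then id else Prod.swap
  have hswap (i : ι) : MeasurePreserving (swap i) ((ν i).prod (ν i)) ((ν i).prod (ν i)) := by
    by_cases h : ε i = 1
    · simpa only [swap, if_pos h] using MeasurePreserving.id _
    · simpa only [swap, if_neg h] using Measure.measurePreserving_swap
  have hpair := measurePreserving_arrowProdEquivProdArrow S S ι ν ν
  convert (hpair.comp (measurePreserving_pi _ _ hswap)).comp (hpair.symm _) using 1
  funext z
  refine Prod.ext (funext fun i => ?_) (funext fun i => ?_) <;>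
    by_cases h : ε i = 1 <;>
    simp [signSwap, swap, h, MeasurableEquiv.arrowProdEquivProdArrow,
      Equiv.arrowProdEquivProdArrow]

variable [NormedAddCommGroup F] [NormedSpace ℝ F] [CompleteSpace F] [MeasurableSpace F]
  {q : ℝ}

theorem eLpNorm_pi_sum_sub_integral_le {ν : ι → Measure F} [∀ i, IsProbabilityMeasure (ν i)]
    (hq : 1 ≤ q) (hν : ∀ i, MemLp id (ENNReal.ofReal q) (ν i)) (ε : ι → ℤˣ) :
    eLpNorm (fun x : ι → F => ∑ i, x i - ∑ i, ∫ y, id y ∂ν i) (ENNReal.ofReal q) (Measure.pi ν)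
      ≤ 2 * eLpNorm (fun x : ι → F => ∑ i, ε i • x i) (ENNReal.ofReal q) (Measure.pi ν) := by
  have hq1 := ENNReal.one_le_ofReal.2 hq
  have hcoord (i : ι) : Integrable (fun x : ι → F => x i) (Measure.pi ν) :=
    (measurePreserving_eval ν i).integrable_comp_of_integrable ((hν i).integrable hq1)
  have hmean : ∫ x, ∑ i, x i ∂Measure.pi ν = ∑ i, ∫ y, id y ∂ν i := by
    rw [integral_finsetSum _ fun i _ => hcoord i]
    refine Finset.sum_congr rfl fun i _ => ?_
    have heval := measurePreserving_eval ν i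
    rw [← heval.map_eq, integral_map heval.measurable.aemeasurable
      (by rw [heval.map_eq]; exact (hν i).1)]
    rfl
  have hsigned : AEStronglyMeasurable (fun x : ι → F => ∑ i, ε i • x i) (Measure.pi ν) :=
    Finset.aestronglyMeasurable_fun_sum _ fun i _ => (hcoord i).1.const_smul (ε i)
  have hdiff : AEStronglyMeasurable (fun z : (ι → F) × (ι → F) => ∑ i, z.1 i - ∑ i, z.2 i)
      ((Measure.pi ν).prod (Measure.pi ν)) :=
    (Finset.aestronglyMeasurable_fun_sum _ fun i _ => (hcoord i).1.comp_fst).sub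
      (Finset.aestronglyMeasurable_fun_sum _ fun i _ => (hcoord i).1.comp_snd)
  calc _ ≤ eLpNorm (fun z : (ι → F) × (ι → F) => ∑ i, z.1 i - ∑ i, z.2 i) (ENNReal.ofReal q)
          ((Measure.pi ν).prod (Measure.pi ν)) := by
        rw [← hmean]
        exact eLpNorm_sub_integral_le_eLpNorm_prod (integrable_finsetSum _ fun i _ => hcoord i) hq
    _ = eLpNorm (fun z : (ι → F) × (ι → F) => ∑ i, ε i • z.1 i - ∑ i, ε i • z.2 i)
          (ENNReal.ofReal q) ((Measure.pi ν).prod (Measure.pi ν)) := by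
        rw [← eLpNorm_comp_measurePreserving hdiff (measurePreserving_signSwap ν ε)]
        simp only [Function.comp_def, ← Finset.sum_sub_distrib, signSwap_fst_sub_snd, smul_sub]
    _ ≤ _ := (eLpNorm_sub_le hsigned.comp_fst hsigned.comp_snd hq1).trans_eq (by
        rw [two_mul]
        exact congrArg₂ _ (eLpNorm_comp_measurePreserving hsigned measurePreserving_fst)
          (eLpNorm_comp_measurePreserving hsigned measurePreserving_snd))

variable [BorelSpace F] {Ω : Type*} [MeasurableSpace Ω] {P : Measure Ω} [IsProbabilityMeasure P]
  {Y : ι → Ω → F}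

theorem eLpNorm_sum_sub_integral_le (hq : 1 ≤ q) (hY : ∀ i, MemLp (Y i) (ENNReal.ofReal q) P)
    (hindep : iIndepFun Y P) (ε : ι → ℤˣ) :
    eLpNorm (fun ω => ∑ i, Y i ω - ∑ i, ∫ ω', Y i ω' ∂P) (ENNReal.ofReal q) P
      ≤ 2 * eLpNorm (fun ω => ∑ i, ε i • Y i ω) (ENNReal.ofReal q) P := by
  have hYm (i : ι) : AEMeasurable (Y i) P := (hY i).1.aemeasurable
  have (i : ι) : IsProbabilityMeasure (P.map (Y i)) := Measure.isProbabilityMeasure_map (hYm i)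
  have hid (i : ι) : AEStronglyMeasurable id (P.map (Y i)) := (hY i).1.aestronglyMeasurable_id_map
  have hmean (i : ι) : ∫ y, id y ∂P.map (Y i) = ∫ ω, Y i ω ∂P := integral_map (hYm i) (hid i)
  have hmap := hindep.map_fun_eq_pi_map hYm
  have hcoord (i : ι) : AEStronglyMeasurable (fun x : ι → F => x i)
      (Measure.pi fun i => P.map (Y i)) :=
    (hid i).comp_measurePreserving (measurePreserving_eval (fun i => P.map (Y i)) i)
  have hsigned : AEStronglyMeasurable (fun x : ι → F => ∑ i, ε i • x i)
      (Measure.pi fun i => P.map (Y i)) :=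
    Finset.aestronglyMeasurable_fun_sum _ fun i _ => (hcoord i).const_smul (ε i)
  have hcentered : AEStronglyMeasurable
      (fun x : ι → F => ∑ i, x i - ∑ i, ∫ y, id y ∂P.map (Y i))
      (Measure.pi fun i => P.map (Y i)) :=
    (Finset.aestronglyMeasurable_fun_sum _ fun i _ => hcoord i).sub aestronglyMeasurable_const
  have htransfer {g : (ι → F) → F}
      (hg : AEStronglyMeasurable g (Measure.pi fun i => P.map (Y i))) :
      eLpNorm g (ENNReal.ofReal q) (Measure.pi fun i => P.map (Y i))
        = eLpNorm (fun ω => g fun i => Y i ω) (ENNReal.ofReal q) P := by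
    rw [← hmap] at hg ⊢
    exact eLpNorm_map_measure hg (aemeasurable_pi_lambda _ hYm)
  have hpi := eLpNorm_pi_sum_sub_integral_le hq
    (fun i => (memLp_map_measure_iff (hid i) (hYm i)).2 (hY i)) ε
  rw [htransfer hsigned, htransfer hcentered] at hpi
  simpa only [hmean] using hpi

theorem lpNorm_sum_sub_integral_rpow_le [DecidableEq ι] (hq : 1 ≤ q)
    (hY : ∀ i, MemLp (Y i) (ENNReal.ofReal q) P) (hindep : iIndepFun Y P) :
    lpNorm (fun ω => ∑ i, Y i ω - ∑ i, ∫ ω', Y i ω' ∂P) (ENNReal.ofReal q) P ^ q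
      ≤ 2 ^ q * ∫ ω, 𝔼 ε : ι → ℤˣ, ‖∑ i, ε i • Y i ω‖ ^ q ∂P := by
  have hq0 : 0 < q := one_pos.trans_le hq
  have hsigned (ε : ι → ℤˣ) : MemLp (fun ω => ∑ i, ε i • Y i ω) (ENNReal.ofReal q) P :=
    memLp_finsetSum _ fun i _ => by
      simpa only [Units.smul_def, ← Int.cast_smul_eq_zsmul ℝ, Pi.smul_def] using
        (hY i).const_smul ((ε i : ℤ) : ℝ)
  have hsum : AEStronglyMeasurable (fun ω => ∑ i, Y i ω - ∑ i, ∫ ω', Y i ω' ∂P) P :=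
    (Finset.aestronglyMeasurable_fun_sum _ fun i _ => (hY i).1).sub aestronglyMeasurable_const
  have hle (ε : ι → ℤˣ) :
      lpNorm (fun ω => ∑ i, Y i ω - ∑ i, ∫ ω', Y i ω' ∂P) (ENNReal.ofReal q) P ^ q
        ≤ 2 ^ q * ∫ ω, ‖∑ i, ε i • Y i ω‖ ^ q ∂P := by
    have h := ENNReal.toReal_mono
      (ENNReal.mul_ne_top ENNReal.ofNat_ne_top (hsigned ε).eLpNorm_ne_top)
      (eLpNorm_sum_sub_integral_le hq hY hindep ε)
    rw [ENNReal.toReal_mul, toReal_eLpNorm hsum, toReal_eLpNorm (hsigned ε).1,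
      ENNReal.toReal_ofNat] at h
    rw [← lpNorm_rpow_eq_integral hq0 (hsigned ε).1, ← Real.mul_rpow zero_le_two lpNorm_nonneg]
    exact Real.rpow_le_rpow lpNorm_nonneg h hq0.le
  have hswap : ∫ ω, 𝔼 ε : ι → ℤˣ, ‖∑ i, ε i • Y i ω‖ ^ q ∂P
      = 𝔼 ε : ι → ℤˣ, ∫ ω, ‖∑ i, ε i • Y i ω‖ ^ q ∂P := by
    simp only [Fintype.expect_eq_sum_div_card]
    rw [integral_div, integral_finsetSum _ fun ε _ => integrable_norm_rpow hq0 (hsigned ε)]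
  rw [hswap, Finset.mul_expect]
  exact Finset.le_expect Finset.univ_nonempty fun ε _ => hle ε

end Symmetrization

section SampleMean

variable {Ω : Type*} [MeasurableSpace Ω] {P : Measure Ω} {E : Type u} [NormedAddCommGroup E]
  {k : ℕ} {p q : ℝ}

theorem memLp_natCast_of_memLp_mul [IsFiniteMeasure P] {ξ : Ω → E} (hq : 1 ≤ q)
    (hξ : MemLp ξ (ENNReal.ofReal (k * q)) P) : MemLp ξ k P := by
  refine hξ.mono_exponent ?_
  rw [← ENNReal.ofReal_natCast]
  exact ENNReal.ofReal_le_ofReal (le_mul_of_one_le_right k.cast_nonneg hq)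

variable [NormedSpace ℝ E]

theorem memLp_symTensorPow {ξ : Ω → E} (hk : k ≠ 0) (hξ : MemLp ξ (ENNReal.ofReal (k * q)) P) :
    MemLp (fun ω => symTensorPow k (ξ ω)) (ENNReal.ofReal q) P := by
  have hpow := hξ.norm_rpow_div k
  rw [ENNReal.ofReal_mul k.cast_nonneg, ENNReal.ofReal_natCast, mul_comm,
    ENNReal.mul_div_cancel_right (Nat.cast_ne_zero.2 hk) (ENNReal.natCast_ne_top k)] at hpow
  simp only [ENNReal.toReal_natCast, Real.rpow_natCast] at hpow
  exact hpow.mono' ((continuous_symTensorPow k E).comp_aestronglyMeasurable hξ.1)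
    (.of_forall fun ω => norm_symTensorPow_le (ξ ω))

theorem memLp_sub_sampleMean [IsFiniteMeasure P] {ξ : Fin n → Ω → E} (hk : k ≠ 0)
    (hξ : ∀ j, MemLp (ξ j) (ENNReal.ofReal (k * q)) P) (U : SymInjTensor k E) :
    MemLp (fun ω => U - (n : ℝ)⁻¹ • ∑ j, symTensorPow k (ξ j ω)) (ENNReal.ofReal q) P :=
  (memLp_const U).sub
    ((memLp_finsetSum _ fun j _ => memLp_symTensorPow hk (hξ j)).const_smul (n : ℝ)⁻¹)

variable [IsProbabilityMeasure P] [MeasurableSpace E] [BorelSpace E] {ξ : Fin n → Ω → E}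

theorem lpNorm_sum_symTensorPow_sub_rpow_le (hp : 1 ≤ p) (hpq : p ≤ q)
    (hE : HasRademacherType E p) (hk : k ≠ 0)
    (hξ : ∀ j, MemLp (ξ j) (ENNReal.ofReal (k * q)) P) (hindep : iIndepFun ξ P) :
    lpNorm (fun ω => ∑ j, symTensorPow k (ξ j ω) - ∑ j, symMoment k (ξ j) P)
        (ENNReal.ofReal q) P ^ q
      ≤ 2 ^ q * ((2 * k * kahaneKhintchineConstant.{u} q p * typeConstant E p) ^ q
        * (n ^ (q / p - 1) * ∑ j, (lpNorm (ξ j) (ENNReal.ofReal (k * q)) P ^ k) ^ q)) := by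
  borelize (SymInjTensor k E)
  have hq : 1 ≤ q := hp.trans hpq
  have hq0 : 0 < q := one_pos.trans_le hq
  have hkq : 0 < k * q := mul_pos (Nat.cast_pos.2 hk.bot_lt) hq0
  have hrpow {a : ℝ} (ha : 0 ≤ a) : (a ^ k) ^ q = a ^ (k * q) := by
    rw [Real.rpow_mul ha, Real.rpow_natCast]
  have hint (j : Fin n) : Integrable (fun ω => (‖ξ j ω‖ ^ k) ^ q) P := by
    simpa only [hrpow (norm_nonneg _)] using integrable_norm_rpow hkq (hξ j)
  have hsym := lpNorm_sum_sub_integral_rpow_le hq (fun j => memLp_symTensorPow hk (hξ j))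
    (hindep.comp _ fun _ => (continuous_symTensorPow k E).measurable)
  simp only [← symMoment_eq_integral hk (memLp_natCast_of_memLp_mul hq (hξ _))] at hsym
  refine hsym.trans (mul_le_mul_of_nonneg_left ?_ (by positivity))
  calc _ ≤ ∫ ω, (2 * k * kahaneKhintchineConstant.{u} q p * typeConstant E p) ^ q
          * (n ^ (q / p - 1) * ∑ j, (‖ξ j ω‖ ^ k) ^ q) ∂P :=
        integral_mono_of_nonneg (.of_forall fun ω => by positivity)
          (((integrable_finsetSum _ fun j _ => hint j).const_mul _).const_mul _)
          (.of_forall fun ω => expect_norm_sum_symTensorPow_rpow_le hp hpq hE hk fun j => ξ j ω)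
    _ = _ := by
        rw [integral_const_mul, integral_const_mul, integral_finsetSum _ fun j _ => hint j]
        simp only [hrpow (norm_nonneg _), hrpow lpNorm_nonneg,
          lpNorm_rpow_eq_integral hkq (hξ _).1]

theorem lpNorm_sum_symTensorPow_sub_le (hp : 1 ≤ p) (hpq : p ≤ q) (hE : HasRademacherType E p)
    (hk : k ≠ 0) (hξ : ∀ j, MemLp (ξ j) (ENNReal.ofReal (k * q)) P) (hindep : iIndepFun ξ P)
    (hident : ∀ i j, IdentDistrib (ξ i) (ξ j) P P) (i : Fin n) :
    lpNorm (fun ω => ∑ j, symTensorPow k (ξ j ω) - (n : ℝ) • symMoment k (ξ i) P)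
        (ENNReal.ofReal q) P
      ≤ 2 * (2 * k * kahaneKhintchineConstant.{u} q p * typeConstant E p) * n ^ (1 / p)
        * lpNorm (ξ i) (ENNReal.ofReal (k * q)) P ^ k := by
  borelize (SymInjTensor k E)
  have hq : 1 ≤ q := hp.trans hpq
  have hq0 : 0 < q := one_pos.trans_le hq
  have hn : (0 : ℝ) < n := Nat.cast_pos.2 i.pos
  have hmoment (j : Fin n) : symMoment k (ξ j) P = symMoment k (ξ i) P := by
    simp only [symMoment_eq_integral hk (memLp_natCast_of_memLp_mul hq (hξ _))]
    exact ((hident j i).comp (continuous_symTensorPow k E).measurable).integral_eq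
  have hnorm (j : Fin n) : lpNorm (ξ j) (ENNReal.ofReal (k * q)) P
      = lpNorm (ξ i) (ENNReal.ofReal (k * q)) P := by
    rw [← toReal_eLpNorm (hξ j).1, ← toReal_eLpNorm (hξ i).1, (hident j i).eLpNorm_eq]
  have hcard : (n : ℝ) ^ (q / p - 1) * n = (n ^ (1 / p)) ^ q := by
    rw [← Real.rpow_add_one hn.ne', sub_add_cancel, ← Real.rpow_mul hn.le, one_div_mul_eq_div]
  have hC : 0 ≤ 2 * k * kahaneKhintchineConstant.{u} q p * typeConstant E p :=
    mul_nonneg (mul_nonneg (by positivity) (kahaneKhintchineConstant_nonneg q p))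
      (typeConstant_nonneg E p)
  have hN : 0 ≤ lpNorm (ξ i) (ENNReal.ofReal (k * q)) P ^ k := pow_nonneg lpNorm_nonneg k
  have hsum := lpNorm_sum_symTensorPow_sub_rpow_le hp hpq hE hk hξ hindep
  simp only [hmoment, hnorm, Finset.sum_const, Finset.card_univ, Fintype.card_fin,
    ← Nat.cast_smul_eq_nsmul ℝ, smul_eq_mul] at hsum
  rw [← mul_assoc ((n : ℝ) ^ _), hcard, ← mul_assoc, ← mul_assoc, ← Real.mul_rpow zero_le_two hC,
    ← Real.mul_rpow (by positivity) (by positivity), ← Real.mul_rpow (by positivity) hN] at hsum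
  exact (Real.rpow_le_rpow_iff lpNorm_nonneg (by positivity) hq0).1 hsum

theorem lpNorm_symMoment_sub_sampleMean_le (hp : 1 ≤ p) (hpq : p ≤ q)
    (hE : HasRademacherType E p) (hk : k ≠ 0)
    (hξ : ∀ j, MemLp (ξ j) (ENNReal.ofReal (k * q)) P) (hindep : iIndepFun ξ P)
    (hident : ∀ i j, IdentDistrib (ξ i) (ξ j) P P) (i : Fin n) :
    lpNorm (fun ω => symMoment k (ξ i) P - (n : ℝ)⁻¹ • ∑ j, symTensorPow k (ξ j ω))
        (ENNReal.ofReal q) P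
      ≤ singleLevelConstant E q p k * n ^ (-(1 - 1 / p))
        * lpNorm (ξ i) (ENNReal.ofReal (k * q)) P ^ k := by
  have hn : (0 : ℝ) < n := Nat.cast_pos.2 i.pos
  have hscale : (fun ω => symMoment k (ξ i) P - (n : ℝ)⁻¹ • ∑ j, symTensorPow k (ξ j ω))
      = (-(n : ℝ)⁻¹) • fun ω => ∑ j, symTensorPow k (ξ j ω) - (n : ℝ) • symMoment k (ξ i) P := by
    funext ω
    rw [Pi.smul_apply, smul_sub, neg_smul, neg_smul, inv_smul_smul₀ hn.ne', sub_neg_eq_add,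
      neg_add_eq_sub]
  have hpow : (n : ℝ)⁻¹ * n ^ (1 / p) = n ^ (-(1 - 1 / p)) := by
    rw [← Real.rpow_neg_one, ← Real.rpow_add hn, neg_sub', sub_neg_eq_add]
  rw [hscale, lpNorm_const_smul, coe_nnnorm, norm_neg, Real.norm_of_nonneg (by positivity)]
  calc _ ≤ (n : ℝ)⁻¹ * (2 * (2 * k * kahaneKhintchineConstant.{u} q p * typeConstant E p)
          * n ^ (1 / p) * lpNorm (ξ i) (ENNReal.ofReal (k * q)) P ^ k) := by
        gcongr
        exact lpNorm_sum_symTensorPow_sub_le hp hpq hE hk hξ hindep hident i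
    _ = 2 * (2 * k * kahaneKhintchineConstant.{u} q p * typeConstant E p)
          * n ^ (-(1 - 1 / p)) * lpNorm (ξ i) (ENNReal.ofReal (k * q)) P ^ k := by
        rw [← hpow]
        ring
    _ ≤ _ := by
        rw [singleLevelConstant]
        gcongr
        · exact pow_nonneg lpNorm_nonneg k
        · exact le_add_of_nonneg_right (khintchineConstant_nonneg q)

theorem lpNorm_sub_sampleMean_le (hp : 1 ≤ p) (hpq : p ≤ q) (hE : HasRademacherType E p)
    (hk : k ≠ 0) (hξ : ∀ j, MemLp (ξ j) (ENNReal.ofReal (k * q)) P) (hindep : iIndepFun ξ P)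
    (hident : ∀ i j, IdentDistrib (ξ i) (ξ j) P P) (i : Fin n) (U : SymInjTensor k E) :
    lpNorm (fun ω => U - (n : ℝ)⁻¹ • ∑ j, symTensorPow k (ξ j ω)) (ENNReal.ofReal q) P
      ≤ ‖U - symMoment k (ξ i) P‖ + singleLevelConstant E q p k * n ^ (-(1 - 1 / p))
        * lpNorm (ξ i) (ENNReal.ofReal (k * q)) P ^ k := by
  have hq : 1 ≤ q := hp.trans hpq
  have hsplit : (fun ω => U - (n : ℝ)⁻¹ • ∑ j, symTensorPow k (ξ j ω))
      = (fun _ => U - symMoment k (ξ i) P)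
        + fun ω => symMoment k (ξ i) P - (n : ℝ)⁻¹ • ∑ j, symTensorPow k (ξ j ω) :=
    funext fun ω => (sub_add_sub_cancel _ _ _).symm
  rw [hsplit]
  refine (lpNorm_add_le (memLp_const _) (ENNReal.one_le_ofReal.2 hq)).trans
    (add_le_add (le_of_eq ?_)
      (lpNorm_symMoment_sub_sampleMean_le hp hpq hE hk hξ hindep hident i))
  rw [lpNorm_const (ENNReal.ofReal_pos.2 (one_pos.trans_le hq)).ne'
    (IsProbabilityMeasure.ne_zero P), probReal_univ, Real.one_rpow, mul_one]

end SampleMean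

end

end MonteCarloMoments

theorem mainTheorem4_general {Ω : Type*} [MeasurableSpace Ω] (P : Measure Ω)
    [IsProbabilityMeasure P] {E : Type*} [NormedAddCommGroup E] [NormedSpace ℝ E]
    [MeasurableSpace E] [BorelSpace E]
    (p q : ℝ) (hp : 1 ≤ p) (hE : HasRademacherType E p) (hq : p ≤ q)
    (k M : ℕ) (hk : 0 < k) (hM : 0 < M) (ξ : Fin M → Ω → E)
    (hξ : ∀ j, MemLp (ξ j) (ENNReal.ofReal (k * q)) P)
    (hindep : iIndepFun ξ P) (hident : ∀ i j, IdentDistrib (ξ i) (ξ j) P P) :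
    Integrable (fun ω => tensorPow k (ξ ⟨0, hM⟩ ω)) P ∧
    (∀ U : SymInjTensor k E,
      MemLp (fun ω => U - (M : ℝ)⁻¹ • ∑ j, symTensorPow k (ξ j ω)) (ENNReal.ofReal q) P ∧
      lpNorm (fun ω => U - (M : ℝ)⁻¹ • ∑ j, symTensorPow k (ξ j ω)) (ENNReal.ofReal q) P
        ≤ ‖U - symMoment k (ξ ⟨0, hM⟩) P‖
          + singleLevelConstant E q p k * (M : ℝ) ^ (-(1 - 1 / p))
            * lpNorm (ξ ⟨0, hM⟩) (ENNReal.ofReal (k * q)) P ^ k) ∧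
    (∀ η : Ω → E, MemLp η k P →
      Integrable (fun ω => tensorPow k (η ω)) P ∧
      ‖symMoment k η P - symMoment k (ξ ⟨0, hM⟩) P‖
        ≤ lpNorm (η - ξ ⟨0, hM⟩) k P
          * ∑ i ∈ Finset.range k, lpNorm η k P ^ i * lpNorm (ξ ⟨0, hM⟩) k P ^ (k - i - 1) ∧
      lpNorm (fun ω => symMoment k η P - (M : ℝ)⁻¹ • ∑ j, symTensorPow k (ξ j ω))
          (ENNReal.ofReal q) P
        ≤ lpNorm (η - ξ ⟨0, hM⟩) k P
            * ∑ i ∈ Finset.range k, lpNorm η k P ^ i * lpNorm (ξ ⟨0, hM⟩) k P ^ (k - i - 1)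
          + singleLevelConstant E q p k * (M : ℝ) ^ (-(1 - 1 / p))
            * lpNorm (ξ ⟨0, hM⟩) (ENNReal.ofReal (k * q)) P ^ k) := by
  have hξk : MemLp (ξ ⟨0, hM⟩) k P := memLp_natCast_of_memLp_mul (hp.trans hq) (hξ ⟨0, hM⟩)
  have hU := lpNorm_sub_sampleMean_le hp hq hE hk.ne' hξ hindep hident ⟨0, hM⟩
  refine ⟨integrable_tensorPow hk.ne' hξk, fun U => ⟨memLp_sub_sampleMean hk.ne' hξ U, hU U⟩,
    fun η hη => ?_⟩
  have hdiff := norm_symMoment_sub_le hk.ne' hη hξk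
  exact ⟨integrable_tensorPow hk.ne' hη, hdiff, (hU _).trans (add_le_add_left hdiff _)⟩

theorem mainTheorem4 {Ω : Type*} [MeasurableSpace Ω] (P : Measure Ω) [IsProbabilityMeasure P]
    {E : Type*} [NormedAddCommGroup E] [NormedSpace ℝ E] [CompleteSpace E]
    [MeasurableSpace E] [BorelSpace E]
    (p q : ℝ) (hp : p ∈ Set.Icc (1 : ℝ) 2) (hE : HasRademacherType E p) (hq : p ≤ q)
    (k M : ℕ) (hk : 0 < k) (hM : 0 < M) (ξ : Fin M → Ω → E)
    (hξ : ∀ j, MemLp (ξ j) (ENNReal.ofReal (k * q)) P)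
    (hindep : iIndepFun ξ P) (hident : ∀ i j, IdentDistrib (ξ i) (ξ j) P P) :
    Integrable (fun ω => tensorPow k (ξ ⟨0, hM⟩ ω)) P ∧
    (∀ U : SymInjTensor k E,
      MemLp (fun ω => U - (M : ℝ)⁻¹ • ∑ j, symTensorPow k (ξ j ω)) (ENNReal.ofReal q) P ∧
      lpNorm (fun ω => U - (M : ℝ)⁻¹ • ∑ j, symTensorPow k (ξ j ω)) (ENNReal.ofReal q) P
        ≤ ‖U - symMoment k (ξ ⟨0, hM⟩) P‖
          + singleLevelConstant E q p k * (M : ℝ) ^ (-(1 - 1 / p))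
            * lpNorm (ξ ⟨0, hM⟩) (ENNReal.ofReal (k * q)) P ^ k) ∧
    (∀ η : Ω → E, MemLp η k P →
      Integrable (fun ω => tensorPow k (η ω)) P ∧
      ‖symMoment k η P - symMoment k (ξ ⟨0, hM⟩) P‖
        ≤ lpNorm (η - ξ ⟨0, hM⟩) k P
          * ∑ i ∈ Finset.range k, lpNorm η k P ^ i * lpNorm (ξ ⟨0, hM⟩) k P ^ (k - i - 1) ∧
      lpNorm (fun ω => symMoment k η P - (M : ℝ)⁻¹ • ∑ j, symTensorPow k (ξ j ω))
          (ENNReal.ofReal q) P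
        ≤ lpNorm (η - ξ ⟨0, hM⟩) k P
            * ∑ i ∈ Finset.range k, lpNorm η k P ^ i * lpNorm (ξ ⟨0, hM⟩) k P ^ (k - i - 1)
          + singleLevelConstant E q p k * (M : ℝ) ^ (-(1 - 1 / p))
            * lpNorm (ξ ⟨0, hM⟩) (ENNReal.ofReal (k * q)) P ^ k) :=
  mainTheorem4_general P p q hp.1 hE hq k M hk hM ξ hξ hindep hident
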